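/- Let $0<q<1$ and $t>0$. On the complex Hilbert space $\ell^2(\mathbb Z)$ with standard orthonormal basis $(e_k)_{k\in\mathbb Z}$ let $J$ be the doubly infinite Jacobi operator, with domain $\mathcal D=\operatorname{span}\{e_k : k\in\mathbb Z\}$, given by $$J e_k = a_k e_{k+1}+b_k e_k+a_{k-1}e_{k-1},\qquad a_k=\frac{1}{\sqrt{t q^{k+1}}},\qquad b_k=-\frac{1}{t q^k},\qquad k\in\mathbb Z .$$ (This is the operator corresponding to $(Lf)(x)=f(xq)-\frac1x f(x)+\frac1x f(x/q)$ on $L^2(\mu_t)$, where $\mu_t=\sum_{k\in\mathbb Z}m_t(k)\,\delta_{tq^k}$ with $m_t(k)>0$ and $m_t(k+1)=tq^{k+1}m_t(k)$, under the unitary map $Uf=\sum_{k} f(tq^k)\sqrt{m_t(k)}\,e_k$.) Then $J$ is closable, its adjoint $J^\ast$ is self-adjoint and equal to the closure of $J$, and the spectrum of $J^\ast$ is $$\sigma(J^\ast)=\Bigl\{-\frac{q^r}{t} : r\in\mathbb Z\Bigr\}\cup\{0\}\cup\{q^n : n\in\mathbb Z,\ n\ge 0\}.$$ The point $0$ is an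 accumulation point of $\sigma(J^\ast)$, but it is not an eigenvalue of $J^\ast$. -/

import Mathlib

open Filter Topology
open scoped LinearPMap

noncomputable section

namespace SWSpectrum

/-! ### Spectrum of an unbounded operator on a complex Hilbert space -/

section Unbounded

variable {H : Type*} [NormedAddCommGroup H] [InnerProductSpace ℂ H]

/-- The resolvent set of a partially defined operator `A`: all `z` for which `A - z` maps the
domain of `A` bijectively onto the whole space and has a bounded (everywhere defined) inverse. -/
def resolventSet (A : H →ₗ.[ℂ] H) : Set ℂ :=
  {z | ∃ R : H →L[ℂ] H,
    (∀ v : H, ∃ hv : R v ∈ A.domain, A ⟨R v, hv⟩ - z • R v = v) ∧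
    ∀ x : A.domain, R (A x - z • (x : H)) = x}

/-- The spectrum is the complement of the resolvent set. -/
def spectrum (A : H →ₗ.[ℂ] H) : Set ℂ := (resolventSet A)ᶜ

/-- The point spectrum is the set of eigenvalues. -/
def pointSpectrum (A : H →ₗ.[ℂ] H) : Set ℂ :=
  {z | ∃ x : A.domain, x ≠ 0 ∧ A x = z • (x : H)}

end Unbounded

/-! ### The doubly infinite Jacobi operator -/

/-- The Hilbert space `ℓ²(ℤ)` of square summable complex sequences indexed by the integers. -/
abbrev EllTwo : Type := lp (fun _ : ℤ => ℂ) 2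

/-- The off-diagonal coefficients `a_k = 1 / √(t q^(k+1))`. -/
def offDiag (q t : ℝ) (k : ℤ) : ℝ := 1 / Real.sqrt (t * q ^ (k + 1))

/-- The diagonal coefficients `b_k = -1 / (t q^k)`. -/
def diag (q t : ℝ) (k : ℤ) : ℝ := -(1 / (t * q ^ k))

/-- The action of the doubly infinite Jacobi matrix on an arbitrary sequence:
`(J v)_k = a_k v_(k+1) + b_k v_k + a_(k-1) v_(k-1)`. -/
def jacobiAction (q t : ℝ) (v : ℤ → ℂ) (k : ℤ) : ℂ :=
  (offDiag q t k : ℂ) * v (k + 1) + (diag q t k : ℂ) * v k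
    + (offDiag q t (k - 1) : ℂ) * v (k - 1)

/-- The subspace of finite linear combinations of the standard basis of `ℓ²(ℤ)`, that is, of the
finitely supported sequences. -/
def finSupp : Submodule ℂ EllTwo where
  carrier := {v | (Function.support (v : ℤ → ℂ)).Finite}
  zero_mem' := by
    rw [Set.mem_ofPred_eq, lp.coeFn_zero, Function.support_zero]
    exact Set.finite_empty
  add_mem' := by
    intro u v hu hv
    refine (hu.union hv).subset ?_
    rw [lp.coeFn_add]
    exact Function.support_add _ _
  smul_mem' := by
    intro c v hv
    refine Set.Finite.subset hv ?_
    rw [lp.coeFn_smul]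
    exact Function.support_const_smul_subset c _

lemma finite_support_jacobiAction (q t : ℝ) {v : ℤ → ℂ} (hv : (Function.support v).Finite) :
    (Function.support (jacobiAction q t v)).Finite := by
  refine ((hv.union (hv.preimage (add_left_injective (1 : ℤ)).injOn)).union
    (hv.preimage (sub_left_injective (b := (1 : ℤ))).injOn)).subset ?_
  intro k hk
  by_contra h
  simp only [Set.mem_union, Set.mem_preimage, Function.mem_support, not_or, not_not] at h
  obtain ⟨⟨h0, h1⟩, h2⟩ := h
  exact hk (by simp [jacobiAction, h0, h1, h2])

lemma memℓp_of_finite_support {v : ℤ → ℂ} (hv : (Function.support v).Finite) :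
    Memℓp v 2 :=
  (memℓp_zero hv).of_exponent_ge zero_le

/-- The Jacobi operator `J` on `ℓ²(ℤ)`, with the finitely supported sequences as its domain. -/
def jacobi (q t : ℝ) : EllTwo →ₗ.[ℂ] EllTwo where
  domain := finSupp
  toFun :=
    { toFun := fun v => ⟨jacobiAction q t ((v : EllTwo) : ℤ → ℂ),
        memℓp_of_finite_support (finite_support_jacobiAction q t v.2)⟩
      map_add' := by
        intro u v
        ext k
        simp only [jacobiAction, Submodule.coe_add, lp.coeFn_add, Pi.add_apply]
        ring
      map_smul' := by
        intro c v
        ext k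
        simp only [jacobiAction, Submodule.coe_smul, lp.coeFn_smul, Pi.smul_apply, smul_eq_mul,
          RingHom.id_apply]
        ring }

/-- The domain of `J` is the linear span of the standard basis. -/
lemma finSupp_eq_span :
    finSupp = Submodule.span ℂ (Set.range fun k : ℤ => (lp.single 2 k (1 : ℂ) : EllTwo)) := by
  apply le_antisymm
  · intro v hv
    have h : v = ∑ k ∈ (show (Function.support (v : ℤ → ℂ)).Finite from hv).toFinset,
        (v k) • (lp.single 2 k (1 : ℂ) : EllTwo) := by
      ext j
      rw [lp.coeFn_sum, Finset.sum_apply]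
      simp only [lp.coeFn_smul, Pi.smul_apply, lp.single_apply, smul_eq_mul]
      by_cases hj : v j = 0 <;> simp [Pi.single_apply, hj]
    rw [h]
    exact Submodule.sum_mem _ fun k _ =>
      Submodule.smul_mem _ _ (Submodule.subset_span ⟨k, rfl⟩)
  · rw [Submodule.span_le]
    rintro _ ⟨k, rfl⟩
    refine (Set.finite_singleton k).subset ?_
    intro j hj
    by_contra h
    exact hj (by simp [lp.single_apply, show j ≠ k from h])

/-- `J` is densely defined, so that its adjoint is the usual one. -/
lemma dense_domain_jacobi (q t : ℝ) : Dense ((jacobi q t).domain : Set EllTwo) := by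
  intro v
  refine mem_closure_of_tendsto (lp.hasSum_single (by norm_num) v)
    (Eventually.of_forall fun s => ?_)
  refine Submodule.sum_mem finSupp fun k _ => ?_
  refine (Set.finite_singleton k).subset ?_
  intro j hj
  by_contra h
  exact hj (by simp [lp.single_apply, show j ≠ k from h])

/-- The second order `q`-difference operator `(L f)(x) = f(xq) - f(x)/x + f(x/q)/x`, which has the
Stieltjes-Wigert polynomials as eigenfunctions. -/
def qDifference (q : ℝ) (f : ℝ → ℂ) (x : ℝ) : ℂ :=
  f (x * q) - (1 / x : ℝ) * f x + (1 / x : ℝ) * f (x / q)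

/-- The Jacobi matrix is the matrix of `L` on `L²(μ_t)`, where `μ_t = ∑ m_t(k) δ_(t q^k)` and
`m_t(k+1) = t q^(k+1) m_t(k)`: it satisfies `J U = U L` for the unitary map
`(U f)_k = f(t q^k) √(m_t(k))` from `L²(μ_t)` to `ℓ²(ℤ)`. -/
lemma jacobiAction_conj (q t : ℝ) (hq : 0 < q) (ht : 0 < t) (m : ℤ → ℝ)
    (hrec : ∀ k, m (k + 1) = t * q ^ (k + 1) * m k) (f : ℝ → ℂ) (k : ℤ) :
    jacobiAction q t (fun j => f (t * q ^ j) * (Real.sqrt (m j) : ℝ)) k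
      = qDifference q f (t * q ^ k) * (Real.sqrt (m k) : ℝ) := by
  have hp : ∀ j : ℤ, 0 < t * q ^ j := fun j => by positivity
  have h1 : offDiag q t k * Real.sqrt (m (k + 1)) = Real.sqrt (m k) := by
    rw [hrec, Real.sqrt_mul (hp _).le, offDiag]
    have := (Real.sqrt_pos.2 (hp (k + 1))).ne'
    field_simp
  have h2 : offDiag q t (k - 1) * Real.sqrt (m (k - 1))
      = 1 / (t * q ^ k) * Real.sqrt (m k) := by
    have h := hrec (k - 1)
    rw [sub_add_cancel] at h
    rw [h, Real.sqrt_mul (hp _).le, offDiag, sub_add_cancel]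
    have h3 := Real.mul_self_sqrt (hp k).le
    have h4 := (Real.sqrt_pos.2 (hp k)).ne'
    have h5 := (hp k).ne'
    rw [← mul_assoc]
    congr 1
    rw [div_mul_eq_mul_div, one_mul, eq_div_iff h5, div_mul_eq_mul_div, one_mul, div_eq_iff h4]
    exact h3.symm
  have e1 : t * q ^ (k + 1) = t * q ^ k * q := by rw [zpow_add_one₀ hq.ne']; ring
  have e2 : t * q ^ (k - 1) = t * q ^ k / q := by
    rw [zpow_sub_one₀ hq.ne']; field_simp
  have h1' : (offDiag q t k : ℂ) * (Real.sqrt (m (k + 1)) : ℝ) = (Real.sqrt (m k) : ℝ) := by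
    rw [← Complex.ofReal_mul, h1]
  have h2' : (offDiag q t (k - 1) : ℂ) * (Real.sqrt (m (k - 1)) : ℝ)
      = (1 / (t * q ^ k) : ℝ) * (Real.sqrt (m k) : ℝ) := by
    rw [← Complex.ofReal_mul, h2, Complex.ofReal_mul]
  simp only [jacobiAction, qDifference, ← e1, ← e2, diag, Complex.ofReal_neg]
  linear_combination f (t * q ^ (k + 1)) * h1' + f (t * q ^ (k - 1)) * h2'

end SWSpectrum

end

noncomputable section

namespace SWSpectrum

/-! ### Square summable sequences -/

/-! The coefficients satisfy `a_(k-1) = √q a_k` and `b_k = -q a_k^2`, with `a_k → 0` at `-∞` and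
`a_k → ∞` at `+∞`. The adjoint of `J` is the maximal operator. On its domain `a_k v_k` is square
summable (`memℓp_offDiag_mul`), so the boundary terms of Lagrange's identity telescope to zero and
the maximal operator is symmetric, hence self-adjoint. The same summability makes basis expansions
converge in the graph norm, so the closure of `J` is the adjoint.

For `z ≠ 0`, dividing row `k` of `J - z` by `b_k - z` gives `1 - K` with `K` compact, because `a_k /
(b_k - z) → 0` at both ends. By the Fredholm alternative a nonzero `z` is in the spectrum only if it
is an eigenvalue (`mem_resolventSet_of_forall_eq_zero`).

The eigenvalue equation is the equation `L f = z f` on the lattice `t q^k`. It has an explicit power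
series solution regular at the origin, and the vanishing of the Casoratian forces every eigenvector
to be a multiple of it (`mul_eigenSeq_comm`). Along `t q^(-K)` the growth of this solution has
leading coefficient `L * theta q (z * t)`, where `L` is the limit of `coeff q z⁻¹`
(`tendsto_partialTheta_mul`). Unless `z = q^n` or `z t = -q^r`, this is nonzero and the solution is
not square summable. In the first exceptional case the solution is a polynomial; in the second a
reflection of the lattice carries its behaviour at `-∞` to that at `+∞`. Both give eigenvectors.

Finally `0` is the limit of the eigenvalues `q^n`, hence in the spectrum, while every nonzero
solution of `J u = 0` stays bounded away from zero towards `-∞`. -/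

lemma memℓp_two_iff {v : ℤ → ℂ} : Memℓp v 2 ↔ Summable fun k => ‖v k‖ ^ 2 := by
  rw [memℓp_gen_iff (by norm_num)]
  simp

lemma memℓp_two_comp {v : ℤ → ℂ} (hv : Memℓp v 2) (e : ℤ ≃ ℤ) : Memℓp (fun k => v (e k)) 2 := by
  rw [memℓp_two_iff] at hv ⊢
  exact (e.summable_iff (f := fun k => ‖v k‖ ^ 2)).2 hv

lemma memℓp_two_mul {v : ℤ → ℂ} (hv : Memℓp v 2) {c : ℤ → ℂ} {C : ℝ} (hc : ∀ k, ‖c k‖ ≤ C) :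
    Memℓp (fun k => c k * v k) 2 := by
  rw [memℓp_two_iff] at hv ⊢
  refine Summable.of_nonneg_of_le (fun k => by positivity) (fun k => ?_) (hv.mul_left (C ^ 2))
  rw [norm_mul, mul_pow]
  gcongr
  exact hc k

lemma memℓp_two_add_one {v : ℤ → ℂ} (hv : Memℓp v 2) : Memℓp (fun k => v (k + 1)) 2 :=
  memℓp_two_comp hv (Equiv.addRight 1)

lemma memℓp_two_sub_one {v : ℤ → ℂ} (hv : Memℓp v 2) : Memℓp (fun k => v (k - 1)) 2 :=
  memℓp_two_comp hv (Equiv.subRight 1)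

lemma tendsto_cofinite_of_memℓp_two {v : ℤ → ℂ} (hv : Memℓp v 2) :
    Tendsto v cofinite (𝓝 0) := by
  rw [memℓp_two_iff] at hv
  rw [tendsto_zero_iff_norm_tendsto_zero]
  have := hv.tendsto_cofinite_zero.sqrt
  simpa using this

lemma atTop_le_cofinite_int : (atTop : Filter ℤ) ≤ cofinite := by
  rw [Int.cofinite_eq]; exact le_sup_right

lemma atBot_le_cofinite_int : (atBot : Filter ℤ) ≤ cofinite := by
  rw [Int.cofinite_eq]; exact le_sup_left

lemma hasSum_single_comp {v : ℤ → ℂ} (hv : Memℓp v 2) (e : ℤ ≃ ℤ) :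
    HasSum (fun k => (lp.single 2 (e k) (v k) : EllTwo))
      ⟨fun k => v (e.symm k), memℓp_two_comp hv e.symm⟩ := by
  rw [← e.symm.hasSum_iff]
  refine cast (congrArg (HasSum · _) (funext fun k => ?_)) (lp.hasSum_single (by norm_num)
    (⟨fun k => v (e.symm k), memℓp_two_comp hv e.symm⟩ : EllTwo))
  simp

/-! ### The coefficients of the Jacobi matrix -/

section Coefficients

variable {q t : ℝ}

lemma offDiag_pos (hq : 0 < q) (ht : 0 < t) (k : ℤ) : 0 < offDiag q t k := by
  unfold offDiag; positivity

lemma offDiag_sub_one (hq : 0 < q) (ht : 0 < t) (k : ℤ) :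
    offDiag q t (k - 1) = √q * offDiag q t k := by
  have h : t * q ^ (k + 1) = q * (t * q ^ (k - 1 + 1)) := by
    rw [sub_add_cancel, zpow_add_one₀ hq.ne']; ring
  unfold offDiag
  rw [h, Real.sqrt_mul hq.le]
  have h1 : 0 < √q := by positivity
  have h2 : 0 < √(t * q ^ (k - 1 + 1)) := by positivity
  field_simp

/-- Being quadratic in `a_k`, the diagonal dominates the matrix at `+∞`, where `a_k` is large. -/
lemma diag_eq (hq : 0 < q) (ht : 0 < t) (k : ℤ) : diag q t k = -(q * offDiag q t k ^ 2) := by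
  unfold diag offDiag
  rw [div_pow, Real.sq_sqrt (by positivity), zpow_add_one₀ hq.ne']
  field_simp

lemma tendsto_zpow_atTop_int (hq : 0 < q) (hq1 : q < 1) :
    Tendsto (fun k : ℤ => q ^ k) atTop (𝓝 0) := by
  rw [← Nat.map_cast_int_atTop, tendsto_map'_iff]
  simpa [Function.comp_def] using tendsto_pow_atTop_nhds_zero_of_lt_one hq.le hq1

lemma tendsto_offDiag_atBot (hq : 0 < q) (hq1 : q < 1) :
    Tendsto (offDiag q t) atBot (𝓝 0) := by
  have h0 : Tendsto (fun k : ℤ => q ^ (-(k + 1))) atBot (𝓝 0) :=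
    (tendsto_zpow_atTop_int hq hq1).comp
      (tendsto_neg_atBot_atTop.comp (tendsto_atBot_add_const_right _ 1 tendsto_id))
  have h1 := (h0.const_mul t⁻¹).sqrt
  rw [mul_zero, Real.sqrt_zero] at h1
  refine h1.congr fun k => ?_
  rw [offDiag, zpow_neg, ← mul_inv, Real.sqrt_inv, one_div]

lemma tendsto_offDiag_atTop (hq : 0 < q) (hq1 : q < 1) (ht : 0 < t) :
    Tendsto (offDiag q t) atTop atTop := by
  have h0 : Tendsto (fun k : ℤ => √(t * q ^ (k + 1))) atTop (𝓝 0) := by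
    have := (((tendsto_zpow_atTop_int hq hq1).comp
      (tendsto_atTop_add_const_right _ 1 tendsto_id)).const_mul t).sqrt
    simpa [Function.comp_def] using this
  have h1 : Tendsto (fun k : ℤ => √(t * q ^ (k + 1))) atTop (𝓝[>] 0) :=
    tendsto_nhdsWithin_iff.2 ⟨h0, .of_forall fun k => Set.mem_Ioi.2 (by positivity)⟩
  refine h1.inv_tendsto_nhdsGT_zero.congr fun k => ?_
  simp [offDiag]

lemma offDiag_antitone_bound (hq : 0 < q) (hq1 : q < 1) (ht : 0 < t) {k : ℤ} (hk : k < 0) :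
    offDiag q t k ≤ (√t)⁻¹ := by
  rw [offDiag, one_div]
  gcongr
  exact le_mul_of_one_le_right ht.le (one_le_zpow_of_nonpos₀ hq hq1.le (by omega))

lemma inv_offDiag_bound (hq : 0 < q) (hq1 : q < 1) (ht : 0 < t) {k : ℤ} (hk : 0 ≤ k) :
    (offDiag q t k)⁻¹ ≤ √t := by
  rw [offDiag, one_div, inv_inv]
  gcongr
  exact mul_le_of_le_one_right ht.le (zpow_le_one₀ hq hq1.le (by omega))

end Coefficients

/-! ### The maximal domain -/

section MaximalDomain

variable {q t : ℝ}

/-- On the maximal domain the sequence `a_k v_k` is square summable: at `-∞` the coefficients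
are bounded, and at `+∞` the diagonal dominates. -/
lemma memℓp_offDiag_mul (hq : 0 < q) (hq1 : q < 1) (ht : 0 < t) {v : ℤ → ℂ} (hv : Memℓp v 2)
    (hw : Memℓp (jacobiAction q t v) 2) : Memℓp (fun k => (offDiag q t k : ℂ) * v k) 2 := by
  -- For `k ≥ 0`, row `k` divided by `-q a_k` expresses `a_k v_k` through `(J v)_k`, `v_(k+1)` and
  -- `v_(k-1)` with bounded coefficients. The four multipliers below combine this with the trivial
  -- identity for `k < 0`.
  have h1 : ∀ k : ℤ, ‖(if k < 0 then (offDiag q t k : ℂ) else 0)‖ ≤ (√t)⁻¹ := fun k => by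
    split_ifs with h
    · rw [Complex.norm_real, Real.norm_of_nonneg (offDiag_pos hq ht k).le]
      exact offDiag_antitone_bound hq hq1 ht h
    · rw [norm_zero]; positivity
  have h2 : ∀ k : ℤ, ‖(if k < 0 then 0 else -(q : ℂ)⁻¹ * (offDiag q t k : ℂ)⁻¹)‖
      ≤ q⁻¹ * √t := fun k => by
    split_ifs with h
    · rw [norm_zero]; positivity
    · rw [norm_mul, norm_neg, norm_inv, norm_inv, Complex.norm_real, Complex.norm_real,
        Real.norm_of_nonneg (offDiag_pos hq ht k).le, Real.norm_of_nonneg hq.le]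
      gcongr
      exact inv_offDiag_bound hq hq1 ht (not_lt.1 h)
  have h3 : ∀ k : ℤ, ‖(if k < 0 then 0 else (q : ℂ)⁻¹)‖ ≤ ‖(q : ℂ)⁻¹‖ := fun k => by
    split_ifs <;> simp
  have h4 : ∀ k : ℤ, ‖(if k < 0 then 0 else (q : ℂ)⁻¹ * (√q : ℝ))‖ ≤ ‖(q : ℂ)⁻¹ * (√q : ℝ)‖ :=
    fun k => by
      split_ifs
      · rw [norm_zero]; positivity
      · exact le_rfl
  have hsum := (((memℓp_two_mul hv h1).add (memℓp_two_mul hw h2)).add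
    (memℓp_two_mul (memℓp_two_add_one hv) h3)).add (memℓp_two_mul (memℓp_two_sub_one hv) h4)
  convert! hsum using 1
  funext k
  simp only [Pi.add_apply, jacobiAction, offDiag_sub_one hq ht, diag_eq hq ht]
  split_ifs with h
  · simp
  · have ha : (offDiag q t k : ℂ) ≠ 0 := by exact_mod_cast (offDiag_pos hq ht k).ne'
    have hq' : (q : ℂ) ≠ 0 := by exact_mod_cast hq.ne'
    push_cast
    field_simp
    ring

/-! ### The adjoint as the maximal operator -/

lemma single_mem_domain (q t : ℝ) (k : ℤ) (c : ℂ) :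
    (lp.single 2 k c : EllTwo) ∈ (jacobi q t).domain := by
  refine (Set.finite_singleton k).subset fun j hj => ?_
  by_contra h
  exact hj (by simp [lp.single_apply, show j ≠ k from h])

lemma jacobi_single (q t : ℝ) (k : ℤ) (c : ℂ) :
    jacobi q t ⟨lp.single 2 k c, single_mem_domain q t k c⟩ =
      lp.single 2 (k + 1) (offDiag q t k * c) + lp.single 2 k (diag q t k * c)
        + lp.single 2 (k - 1) (offDiag q t (k - 1) * c) := by
  ext j
  change jacobiAction q t _ j = _
  simp only [jacobiAction, lp.coeFn_add, Pi.add_apply, lp.single_apply, Pi.single_apply]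
  rcases eq_or_ne j (k + 1) with rfl | h1
  · have h1 : k + 1 + 1 ≠ k := by omega
    have h2 : k + 1 ≠ k - 1 := by omega
    simp [h1, h2]
  rcases eq_or_ne j (k - 1) with rfl | h2
  · have h3 : k - 1 - 1 ≠ k := by omega
    simp [h1, h3]
  have h1' : j - 1 ≠ k := by omega
  have h2' : j + 1 ≠ k := by omega
  rcases eq_or_ne j k with rfl | h3
  · simp [h1, h2]
  · simp [h1, h2, h3, h1', h2']

lemma inner_jacobi_single (q t : ℝ) (v : EllTwo) (k : ℤ) (c : ℂ) :
    inner ℂ v (jacobi q t ⟨lp.single 2 k c, single_mem_domain q t k c⟩) =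
      inner ℂ (jacobiAction q t v k) c := by
  rw [jacobi_single]
  simp only [inner_add_right, lp.inner_single_right, RCLike.inner_apply, jacobiAction, map_add,
    map_mul, Complex.conj_ofReal]
  ring

lemma adjoint_apply_eq_jacobiAction (q t : ℝ) (v : (jacobi q t)†.domain) (k : ℤ) :
    ((jacobi q t)† v) k = jacobiAction q t (v : EllTwo) k := by
  have h := LinearPMap.adjoint_isFormalAdjoint (dense_domain_jacobi q t) v
    ⟨lp.single 2 k 1, single_mem_domain q t k 1⟩
  rw [inner_jacobi_single, lp.inner_single_right] at h
  simpa only [RCLike.inner_apply, one_mul, RCLike.star_def, star_inj] using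
    star_injective (by simpa using h)

/-- The defining identity of the adjoint need only be tested on basis vectors, which span the domain
of `J`; no boundary condition arises. -/
lemma mem_adjoint_domain_iff (q t : ℝ) (v : EllTwo) :
    v ∈ (jacobi q t)†.domain ↔ Memℓp (jacobiAction q t v) 2 := by
  constructor
  · intro hv
    convert lp.memℓp ((jacobi q t)† ⟨v, hv⟩) using 1
    funext k
    exact (adjoint_apply_eq_jacobiAction q t ⟨v, hv⟩ k).symm
  · intro hv
    refine LinearPMap.mem_adjoint_domain_of_exists v ⟨⟨jacobiAction q t v, hv⟩, ?_⟩
    suffices h : ∀ x ∈ finSupp, ∀ hx : x ∈ (jacobi q t).domain,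
        inner ℂ (⟨jacobiAction q t v, hv⟩ : EllTwo) x = inner ℂ v (jacobi q t ⟨x, hx⟩) from
      fun x => h x x.2 x.2
    rw [finSupp_eq_span]
    intro x hx
    induction hx using Submodule.span_induction with
    | mem x hx =>
      obtain ⟨k, rfl⟩ := hx
      intro hx
      rw [inner_jacobi_single, lp.inner_single_right]
    | zero =>
      intro hx
      rw [show (⟨0, hx⟩ : (jacobi q t).domain) = 0 from rfl, LinearPMap.map_zero, inner_zero_right,
        inner_zero_right]
    | add x y hx hy h1 h2 =>
      intro hxy
      rw [← finSupp_eq_span] at hx hy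
      rw [show (⟨x + y, hxy⟩ : (jacobi q t).domain) = ⟨x, hx⟩ + ⟨y, hy⟩ from rfl,
        LinearPMap.map_add, inner_add_right, inner_add_right, h1 hx, h2 hy]
    | smul c x hx h1 =>
      intro hcx
      rw [← finSupp_eq_span] at hx
      rw [show (⟨c • x, hcx⟩ : (jacobi q t).domain) = c • ⟨x, hx⟩ from rfl,
        LinearPMap.map_smul, inner_smul_right, inner_smul_right, h1 hx]

lemma memℓp_offDiag_mul_of_mem (hq : 0 < q) (hq1 : q < 1) (ht : 0 < t) {v : EllTwo}
    (hv : v ∈ (jacobi q t)†.domain) : Memℓp (fun k => (offDiag q t k : ℂ) * v k) 2 :=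
  memℓp_offDiag_mul hq hq1 ht (lp.memℓp v) ((mem_adjoint_domain_iff q t v).1 hv)

/-- The maximal operator is symmetric: the boundary terms are summable and telescope. -/
lemma isFormalAdjoint_adjoint_self (hq : 0 < q) (hq1 : q < 1) (ht : 0 < t) :
    (jacobi q t)†.IsFormalAdjoint (jacobi q t)† := by
  intro u v
  have hu := memℓp_offDiag_mul_of_mem hq hq1 ht u.2
  have hv := memℓp_offDiag_mul_of_mem hq hq1 ht v.2
  set U : EllTwo := ⟨_, hu⟩ with hU
  set V : EllTwo := ⟨_, hv⟩ with hV
  set u' : EllTwo := ⟨_, memℓp_two_add_one (lp.memℓp (u : EllTwo))⟩ with hu'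
  set v' : EllTwo := ⟨_, memℓp_two_add_one (lp.memℓp (v : EllTwo))⟩ with hv'
  -- These are the Casoratian terms of the conjugate of `u` with `v`; attaching `a_k` to the
  -- unshifted factor makes each an inner product of two square summable sequences.
  have h1 := (lp.summable_inner (𝕜 := ℂ) u' V).sub (lp.summable_inner (𝕜 := ℂ) U v')
  have h2 : HasSum _ _ := h1.hasSum
  have h3 := h2.sub ((Equiv.subRight (1 : ℤ)).hasSum_iff.2 h2)
  rw [sub_self] at h3
  have h4 := (lp.hasSum_inner (𝕜 := ℂ) ((jacobi q t)† u) v).sub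
    (lp.hasSum_inner (𝕜 := ℂ) (u : EllTwo) ((jacobi q t)† v))
  rw [← sub_eq_zero]
  refine h4.unique ?_
  convert! h3 using 1
  funext k
  simp only [adjoint_apply_eq_jacobiAction, hU, hV, hu', hv', Function.comp_apply,
    Equiv.subRight_apply, RCLike.inner_apply, jacobiAction, map_add, map_mul, Complex.conj_ofReal,
    sub_add_cancel]
  ring

lemma jacobi_le_adjoint (q t : ℝ) : jacobi q t ≤ (jacobi q t)† := by
  refine ⟨fun v hv => ?_, ?_⟩
  · rw [mem_adjoint_domain_iff]
    exact memℓp_of_finite_support (finite_support_jacobiAction q t hv)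
  · intro x y hxy
    ext k
    rw [adjoint_apply_eq_jacobiAction, ← hxy]
    rfl

lemma dense_domain_adjoint (q t : ℝ) : Dense ((jacobi q t)†.domain : Set EllTwo) :=
  (dense_domain_jacobi q t).mono (jacobi_le_adjoint q t).1

/-- Since `J` is contained in its adjoint, the double adjoint is contained in the adjoint; the
reverse inclusion is the symmetry of the maximal operator. -/
theorem isSelfAdjoint_adjoint (hq : 0 < q) (hq1 : q < 1) (ht : 0 < t) :
    IsSelfAdjoint (jacobi q t)† := by
  rw [LinearPMap.isSelfAdjoint_def]
  refine le_antisymm ?_ ?_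
  · refine LinearPMap.IsFormalAdjoint.le_adjoint (dense_domain_jacobi q t) fun x y => ?_
    have h := LinearPMap.adjoint_isFormalAdjoint (dense_domain_adjoint q t) y
      ⟨x, (jacobi_le_adjoint q t).1 x.2⟩
    rw [(jacobi_le_adjoint q t).2 (x := x) (y := ⟨x, (jacobi_le_adjoint q t).1 x.2⟩) rfl]
    rw [← inner_conj_symm, ← inner_conj_symm (x : EllTwo)]
    exact congrArg _ h.symm
  · exact LinearPMap.IsFormalAdjoint.le_adjoint (dense_domain_adjoint q t)
      (isFormalAdjoint_adjoint_self hq hq1 ht)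

theorem isClosable_jacobi (q t : ℝ) : (jacobi q t).IsClosable :=
  LinearPMap.isClosable_iff_exists_closed_extension.2
    ⟨_, LinearPMap.adjoint_isClosed (dense_domain_jacobi q t), jacobi_le_adjoint q t⟩

/-- The finitely supported sequences are a core: the expansion of `v` in the standard basis
converges in the graph norm. -/
lemma mem_closure_graph (hq : 0 < q) (hq1 : q < 1) (ht : 0 < t) (v : (jacobi q t)†.domain) :
    ((v : EllTwo), (jacobi q t)† v) ∈ (jacobi q t).graph.topologicalClosure := by
  have ha := memℓp_offDiag_mul_of_mem hq hq1 ht v.2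
  have ha' : Memℓp (fun k => (offDiag q t (k - 1) : ℂ) * (v : EllTwo) k) 2 := by
    have h := memℓp_two_mul ha (c := fun _ => (√q : ℂ)) (C := ‖(√q : ℂ)‖) fun _ => le_rfl
    refine cast (congrArg (Memℓp · 2) (funext fun k => ?_)) h
    rw [offDiag_sub_one hq ht]
    push_cast
    ring
  -- The diagonal part is what remains of `J v` after removing the two off-diagonal parts, so each
  -- of the three diagonals acts separately within `ℓ²`.
  have hb : Memℓp (fun k => (diag q t k : ℂ) * (v : EllTwo) k) 2 := by
    have h := (((mem_adjoint_domain_iff q t v).1 v.2).sub (memℓp_two_comp ha'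
      (Equiv.addRight 1))).sub (memℓp_two_comp ha (Equiv.subRight 1))
    refine cast (congrArg (Memℓp · 2) (funext fun k => ?_)) h
    simp only [Pi.sub_apply, jacobiAction, Equiv.coe_addRight, Equiv.subRight_apply,
      add_sub_cancel_right]
    ring
  have h1 := hasSum_single_comp ha (Equiv.addRight 1)
  have h2 := hasSum_single_comp hb (Equiv.refl ℤ)
  have h3 := hasSum_single_comp ha' (Equiv.subRight 1)
  have h4 : HasSum (fun k => jacobi q t ⟨lp.single 2 k ((v : EllTwo) k),
      single_mem_domain q t k _⟩) ((jacobi q t)† v) := by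
    simp_rw [jacobi_single]
    convert! (h1.add h2).add h3 using 1
    ext j
    rw [adjoint_apply_eq_jacobiAction, jacobiAction]
    change _ = (offDiag q t (j - 1) : ℂ) * (v : EllTwo) (j - 1) + diag q t j * (v : EllTwo) j
      + (offDiag q t (j + 1 - 1) : ℂ) * (v : EllTwo) (j + 1)
    rw [add_sub_cancel_right]
    ring
  refine mem_closure_of_tendsto ((lp.hasSum_single (by norm_num) (v : EllTwo)).prodMk h4)
    (Eventually.of_forall fun s => Submodule.sum_mem _ fun k _ => ?_)
  exact LinearPMap.mem_graph _ ⟨lp.single 2 k ((v : EllTwo) k), single_mem_domain q t k _⟩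

theorem closure_jacobi (hq : 0 < q) (hq1 : q < 1) (ht : 0 < t) :
    (jacobi q t).closure = (jacobi q t)† := by
  have hcl := isClosable_jacobi q t
  refine LinearPMap.eq_of_eq_graph ?_
  rw [← hcl.graph_closure_eq_closure_graph]
  refine le_antisymm ?_ ?_
  · exact Submodule.topologicalClosure_minimal _
      (LinearPMap.le_graph_of_le (jacobi_le_adjoint q t))
      (LinearPMap.adjoint_isClosed (dense_domain_jacobi q t))
  · rintro ⟨x, y⟩ hxy
    obtain ⟨v, rfl, rfl⟩ := (LinearPMap.mem_graph_iff _).1 hxy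
    exact mem_closure_graph hq hq1 ht v

end MaximalDomain

/-! ### Multipliers and shifts on `ℓ²(ℤ)` -/

/-- Multiplication by a bounded sequence. -/
def multiplier (c : ℤ → ℂ) {C : ℝ} (hc : ∀ k, ‖c k‖ ≤ C) : EllTwo →L[ℂ] EllTwo :=
  LinearMap.mkContinuous
    { toFun := fun v => ⟨fun k => c k * v k, memℓp_two_mul (lp.memℓp v) hc⟩
      map_add' := fun u v => by
        ext k
        exact mul_add _ _ _
      map_smul' := fun a v => by
        ext k
        exact mul_left_comm _ _ _ }
    C fun v => by
      have hC : 0 ≤ C := (norm_nonneg _).trans (hc 0)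
      have h := lp.norm_mono (p := 2) (by norm_num)
        (x := ⟨fun k => c k * v k, memℓp_two_mul (lp.memℓp v) hc⟩) (y := (C : ℂ) • v) fun k => by
          rw [lp.coeFn_smul, Pi.smul_apply, norm_smul, norm_mul, Complex.norm_real,
            Real.norm_of_nonneg hC]
          gcongr
          exact hc k
      rwa [norm_smul, Complex.norm_real, Real.norm_of_nonneg hC] at h

@[simp]
lemma multiplier_apply (c : ℤ → ℂ) {C : ℝ} (hc : ∀ k, ‖c k‖ ≤ C) (v : EllTwo) (k : ℤ) :
    multiplier c hc v k = c k * v k := rfl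

/-- Reindexing along a permutation of `ℤ`. -/
def reindex (e : ℤ ≃ ℤ) : EllTwo →L[ℂ] EllTwo :=
  LinearMap.mkContinuous
    { toFun := fun v => ⟨fun k => v (e k), memℓp_two_comp (lp.memℓp v) e⟩
      map_add' := fun _ _ => rfl
      map_smul' := fun _ _ => rfl }
    1 fun v => by
      rw [one_mul]
      refine lp.norm_le_of_tsum_le (by norm_num) (norm_nonneg _) ?_
      rw [lp.norm_rpow_eq_tsum (by norm_num)]
      exact (e.tsum_eq fun k => ‖v k‖ ^ (2 : ENNReal).toReal).le

/-- Multiplication by a sequence tending to zero is compact. -/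
lemma isCompactOperator_multiplier {c : ℤ → ℂ} {C : ℝ} (hc : ∀ k, ‖c k‖ ≤ C)
    (h0 : Tendsto c cofinite (𝓝 0)) : IsCompactOperator (multiplier c hc) := by
  -- Finite rank truncations; the norm of the error is at most the supremum of `‖c k‖` off `s`.
  let F : Finset ℤ → EllTwo →L[ℂ] EllTwo := fun s =>
    ∑ k ∈ s, c k • (lp.singleContinuousLinearMap ℂ (fun _ : ℤ => ℂ) 2 k ∘L
      lp.evalCLM ℂ (fun _ : ℤ => ℂ) 2 k)
  have hF : ∀ (s : Finset ℤ) (v : EllTwo) (j : ℤ), F s v j = if j ∈ s then c j * v j else 0 := by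
    intro s v j
    simp only [F, _root_.sum_apply, lp.coeFn_sum, Finset.sum_apply]
    have h : ∀ k ∈ s, (c k • (lp.singleContinuousLinearMap ℂ (fun _ : ℤ => ℂ) 2 k ∘L
        lp.evalCLM ℂ (fun _ : ℤ => ℂ) 2 k)) v j = if j = k then c j * v j else 0 := fun k _ => by
      change c k * (lp.single 2 k (v k) : EllTwo) j = _
      rw [lp.single_apply, Pi.single_apply]
      split_ifs with hjk
      · rw [hjk]
      · exact mul_zero _
    rw [Finset.sum_congr rfl h, Finset.sum_ite_eq]
  refine isCompactOperator_of_tendsto (l := atTop) (F := F) ?_ (Eventually.of_forall fun s => ?_)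
  · rw [Metric.tendsto_atTop]
    intro ε hε
    have h1 := (Metric.tendsto_nhds.1 h0 (ε / 2) (by positivity))
    rw [eventually_cofinite] at h1
    refine ⟨h1.toFinset, fun s hs => ?_⟩
    rw [dist_eq_norm]
    refine (ContinuousLinearMap.opNorm_le_bound _ (by positivity : 0 ≤ ε / 2) fun v => ?_).trans_lt
      (by linarith)
    have h := lp.norm_mono (p := 2) (by norm_num)
      (x := (F s - multiplier c hc) v) (y := ((ε / 2 : ℝ) : ℂ) • v) fun k => by
        rw [lp.coeFn_smul, Pi.smul_apply, norm_smul, Complex.norm_real,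
          Real.norm_of_nonneg (by positivity), _root_.sub_apply, lp.coeFn_sub,
          Pi.sub_apply, hF, multiplier_apply]
        split_ifs with hk
        · rw [sub_self, norm_zero]; positivity
        · have h2 : k ∉ h1.toFinset := fun h => hk (hs h)
          simp only [dist_zero_right, not_lt, Set.Finite.mem_toFinset, Set.mem_ofPred_eq,
            not_le] at h2
          rw [zero_sub, norm_neg, norm_mul]
          gcongr
    rwa [norm_smul, Complex.norm_real, Real.norm_of_nonneg (by positivity)] at h
  · refine Submodule.sum_mem (compactOperator (RingHom.id ℂ) EllTwo EllTwo) fun k _ =>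
      Submodule.smul_mem _ _ ?_
    exact IsCompactOperator.comp_clm (M₂ := ℂ) (isCompactOperator_of_locallyCompactSpace_rng
      (lp.singleContinuousLinearMap ℂ (fun _ : ℤ => ℂ) 2 k)) _

lemma exists_norm_le_of_tendsto_cofinite {c : ℤ → ℂ} {z : ℂ} (h : Tendsto c cofinite (𝓝 z)) :
    ∃ C, ∀ k, ‖c k‖ ≤ C := by
  obtain ⟨C, hC⟩ := h.norm.isBoundedUnder_le.bddAbove_range_of_cofinite
  exact ⟨C, fun k => hC ⟨k, rfl⟩⟩

/-! ### The resolvent away from zero -/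

section Resolvent

variable {q t : ℝ}

lemma tendsto_diag_atBot (hq : 0 < q) (hq1 : q < 1) (ht : 0 < t) :
    Tendsto (fun k => (diag q t k : ℂ)) atBot (𝓝 0) := by
  simp_rw [diag_eq hq ht]
  have := (((tendsto_offDiag_atBot (t := t) hq hq1).pow 2).const_mul q).neg
  simpa [Function.comp_def] using (Complex.continuous_ofReal.tendsto _).comp this

/-- The inverse of `b_k - z`, modified where it is undefined. -/
def diagInv (q t : ℝ) (z : ℂ) (k : ℤ) : ℂ :=
  if (diag q t k : ℂ) = z then 1 else ((diag q t k : ℂ) - z)⁻¹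

/-- The exceptional value `1` serves to keep the row scaling injective; for `z ≠ 0` only finitely
many rows are affected. -/
lemma diagInv_ne_zero (q t : ℝ) (z : ℂ) (k : ℤ) : diagInv q t z k ≠ 0 := by
  unfold diagInv
  split_ifs with h
  · exact one_ne_zero
  · exact inv_ne_zero (sub_ne_zero.2 h)

lemma tendsto_inv_offDiag_atTop (hq : 0 < q) (hq1 : q < 1) (ht : 0 < t) :
    Tendsto (fun k => ((offDiag q t k : ℂ))⁻¹) atTop (𝓝 0) := by
  have := (Complex.continuous_ofReal.tendsto _).comp
    (tendsto_inv_atTop_zero.comp (tendsto_offDiag_atTop hq hq1 ht))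
  simpa [Function.comp_def] using this

/-- `a_k / (b_k - z)` tends to zero at `+∞`. -/
lemma tendsto_offDiag_div_atTop (hq : 0 < q) (hq1 : q < 1) (ht : 0 < t) (z : ℂ) :
    (∀ᶠ k in atTop, (diag q t k : ℂ) ≠ z) ∧
    Tendsto (fun k => ((diag q t k : ℂ) - z)⁻¹ * offDiag q t k) atTop (𝓝 0) := by
  have h0 := tendsto_inv_offDiag_atTop hq hq1 ht
  have h1 : Tendsto (fun k => -(q : ℂ) - z * ((offDiag q t k : ℂ)⁻¹) ^ 2) atTop
      (𝓝 (-(q : ℂ))) := by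
    simpa using ((h0.pow 2).const_mul z).const_sub (-(q : ℂ))
  have hq' : -(q : ℂ) ≠ 0 := by simpa using hq.ne'
  have ha : ∀ k, (offDiag q t k : ℂ) ≠ 0 := fun k => by exact_mod_cast (offDiag_pos hq ht k).ne'
  have h2 : ∀ k, (diag q t k : ℂ) - z =
      (offDiag q t k : ℂ) ^ 2 * (-(q : ℂ) - z * ((offDiag q t k : ℂ)⁻¹) ^ 2) := fun k => by
    rw [diag_eq hq ht]
    have := ha k
    push_cast
    field_simp
  constructor
  · filter_upwards [h1.eventually_ne hq'] with k hk
    rw [← sub_ne_zero, h2]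
    exact mul_ne_zero (pow_ne_zero _ (ha k)) hk
  · have h3 := h0.mul (h1.inv₀ hq')
    rw [zero_mul] at h3
    refine h3.congr fun k => ?_
    rw [h2, mul_inv]
    have := ha k
    field_simp

lemma tendsto_cofinite_int {f : ℤ → ℂ} {z : ℂ} (hb : Tendsto f atBot (𝓝 z))
    (ht : Tendsto f atTop (𝓝 z)) : Tendsto f cofinite (𝓝 z) := by
  rw [Int.cofinite_eq]
  exact hb.sup ht

lemma eventually_diag_ne (hq : 0 < q) (hq1 : q < 1) (ht : 0 < t) {z : ℂ} (hz : z ≠ 0) :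
    ∀ᶠ k in cofinite, (diag q t k : ℂ) ≠ z := by
  rw [Int.cofinite_eq]
  exact eventually_sup.2 ⟨(tendsto_diag_atBot hq hq1 ht).eventually_ne hz.symm,
    (tendsto_offDiag_div_atTop hq hq1 ht z).1⟩

lemma diagInv_eventuallyEq (hq : 0 < q) (hq1 : q < 1) (ht : 0 < t) {z : ℂ} (hz : z ≠ 0) :
    ∀ᶠ k in cofinite, diagInv q t z k = ((diag q t k : ℂ) - z)⁻¹ := by
  filter_upwards [eventually_diag_ne hq hq1 ht hz] with k hk
  rw [diagInv, if_neg hk]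

lemma tendsto_diagInv_mul_offDiag (hq : 0 < q) (hq1 : q < 1) (ht : 0 < t) {z : ℂ} (hz : z ≠ 0) :
    Tendsto (fun k => diagInv q t z k * offDiag q t k) cofinite (𝓝 0) := by
  have h : Tendsto (fun k => ((diag q t k : ℂ) - z)⁻¹ * offDiag q t k) cofinite (𝓝 0) := by
    refine tendsto_cofinite_int ?_ (tendsto_offDiag_div_atTop hq hq1 ht z).2
    have h1 := ((tendsto_diag_atBot hq hq1 ht).sub_const z).inv₀ (by simpa using hz)
    have h2 := (Complex.continuous_ofReal.tendsto _).comp (tendsto_offDiag_atBot (t := t) hq hq1)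
    simpa using h1.mul h2
  refine h.congr' ?_
  filter_upwards [diagInv_eventuallyEq hq hq1 ht hz] with k hk
  rw [hk]

lemma exists_norm_diagInv_le (hq : 0 < q) (hq1 : q < 1) (ht : 0 < t) {z : ℂ} (hz : z ≠ 0) :
    ∃ C, ∀ k, ‖diagInv q t z k‖ ≤ C := by
  have hb : Tendsto (fun k => ((diag q t k : ℂ) - z)⁻¹) atBot (𝓝 (-z)⁻¹) := by
    simpa using ((tendsto_diag_atBot hq hq1 ht).sub_const z).inv₀ (by simpa using hz)
  have htop : Tendsto (fun k => ((diag q t k : ℂ) - z)⁻¹) atTop (𝓝 0) := by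
    have h := (tendsto_offDiag_div_atTop hq hq1 ht z).2.mul (tendsto_inv_offDiag_atTop hq hq1 ht)
    rw [zero_mul] at h
    refine h.congr fun k => ?_
    have : (offDiag q t k : ℂ) ≠ 0 := by exact_mod_cast (offDiag_pos hq ht k).ne'
    field_simp
  have h : IsBoundedUnder (· ≤ ·) cofinite fun k => ‖diagInv q t z k‖ := by
    have h1 : IsBoundedUnder (· ≤ ·) cofinite fun k => ‖((diag q t k : ℂ) - z)⁻¹‖ := by
      obtain ⟨B, hB⟩ := hb.norm.isBoundedUnder_le
      obtain ⟨B', hB'⟩ := htop.norm.isBoundedUnder_le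
      refine isBoundedUnder_of_eventually_le (a := max B B') ?_
      rw [Int.cofinite_eq]
      exact eventually_sup.2 ⟨(eventually_map.1 hB).mono fun k hk => hk.trans (le_max_left _ _),
        (eventually_map.1 hB').mono fun k hk => hk.trans (le_max_right _ _)⟩
    refine h1.mono_le ?_
    filter_upwards [diagInv_eventuallyEq hq hq1 ht hz] with k hk
    rw [hk]
  obtain ⟨C, hC⟩ := h.bddAbove_range_of_cofinite
  exact ⟨C, fun k => hC ⟨k, rfl⟩⟩

/-- A nonzero `z` without square summable eigenvector lies in the resolvent set: dividing the
equation `(J - z) v = w` by the diagonal turns it into `(1 - K) v = w'` with `K` compact. -/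
theorem mem_resolventSet_of_forall_eq_zero (hq : 0 < q) (hq1 : q < 1) (ht : 0 < t) {z : ℂ}
    (hz : z ≠ 0)
    (h : ∀ v : EllTwo, (∀ k, jacobiAction q t v k = z * v k) → v = 0) :
    z ∈ resolventSet (jacobi q t)† := by
  obtain ⟨C, hC⟩ := exists_norm_diagInv_le hq hq1 ht hz
  -- This diagonal part of `K` vanishes except where `b_k = z`.
  have t0 : Tendsto (fun k => 1 - diagInv q t z k * (diag q t k - z)) cofinite (𝓝 0) := by
    refine tendsto_const_nhds.congr' ?_
    filter_upwards [eventually_diag_ne hq hq1 ht hz, diagInv_eventuallyEq hq hq1 ht hz] with k h1 h2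
    rw [h2, inv_mul_cancel₀ (sub_ne_zero.2 h1), sub_self]
  have t1 : Tendsto (fun k => -(diagInv q t z k * offDiag q t k)) cofinite (𝓝 0) := by
    simpa using (tendsto_diagInv_mul_offDiag hq hq1 ht hz).neg
  have t2 : Tendsto (fun k => -(diagInv q t z k * offDiag q t (k - 1))) cofinite (𝓝 0) := by
    have := t1.const_mul (√q : ℂ)
    rw [mul_zero] at this
    refine this.congr fun k => ?_
    rw [offDiag_sub_one hq ht]
    push_cast
    ring
  obtain ⟨C0, h0⟩ := exists_norm_le_of_tendsto_cofinite t0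
  obtain ⟨C1, h1⟩ := exists_norm_le_of_tendsto_cofinite t1
  obtain ⟨C2, h2⟩ := exists_norm_le_of_tendsto_cofinite t2
  let K : EllTwo →L[ℂ] EllTwo := multiplier _ h0 + multiplier _ h1 ∘L reindex (Equiv.addRight 1)
    + multiplier _ h2 ∘L reindex (Equiv.subRight 1)
  have hK : IsCompactOperator K :=
    ((isCompactOperator_multiplier h0 t0).add
      ((isCompactOperator_multiplier h1 t1).comp_clm _)).add
      ((isCompactOperator_multiplier h2 t2).comp_clm _)
  have hKv : ∀ (v : EllTwo) (k : ℤ),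
      v k - K v k = diagInv q t z k * (jacobiAction q t v k - z * v k) := fun v k => by
    change v k - ((1 - diagInv q t z k * (diag q t k - z)) * v k
      + -(diagInv q t z k * offDiag q t k) * v (k + 1)
      + -(diagInv q t z k * offDiag q t (k - 1)) * v (k - 1)) = _
    rw [jacobiAction]
    ring
  -- Fredholm alternative: a fixed vector of `K` would solve `J v = z v`.
  have hres : (1 : ℂ) ∈ _root_.resolventSet ℂ K := by
    refine (hK.hasEigenvalue_or_mem_resolventSet one_ne_zero).resolve_left fun hev => ?_
    obtain ⟨v, hv⟩ := hev.exists_hasEigenvector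
    refine hv.2 (h v fun k => ?_)
    have h3 : K v = v := by simpa using hv.apply_eq_smul
    have h4 := hKv v k
    rw [h3, sub_self] at h4
    exact sub_eq_zero.1 ((mul_eq_zero.1 h4.symm).resolve_left (diagInv_ne_zero q t z k))
  obtain ⟨S, hS⟩ := spectrum.mem_resolventSet_iff.1 hres
  rw [map_one] at hS
  have hSv : ∀ (v : EllTwo) (k : ℤ),
      (S : EllTwo →L[ℂ] EllTwo) v k = diagInv q t z k * (jacobiAction q t v k - z * v k) :=
    fun v k => by
      rw [hS, ← hKv]
      rfl
  -- With `S = 1 - K` equal to the scaled `J - z`, the resolvent is the row scaling followed by the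
  -- inverse of `S`.
  let R : EllTwo →L[ℂ] EllTwo := ((S⁻¹ : (EllTwo →L[ℂ] EllTwo)ˣ) : EllTwo →L[ℂ] EllTwo)
    ∘L multiplier _ hC
  have hSR : ∀ v, (S : EllTwo →L[ℂ] EllTwo) (R v) = multiplier _ hC v := fun v =>
    congrArg (fun T : EllTwo →L[ℂ] EllTwo => T (multiplier _ hC v)) S.mul_inv
  have hRS : ∀ v, ((S⁻¹ : (EllTwo →L[ℂ] EllTwo)ˣ) : EllTwo →L[ℂ] EllTwo)
      ((S : EllTwo →L[ℂ] EllTwo) v) = v := fun v =>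
    congrArg (fun T : EllTwo →L[ℂ] EllTwo => T v) S.inv_mul
  have hR : ∀ v k, jacobiAction q t (R v) k = v k + z * R v k := fun v k => by
    have h3 := congrArg (fun w : EllTwo => w k) (hSR v)
    simp only [hSv, multiplier_apply] at h3
    linear_combination mul_left_cancel₀ (diagInv_ne_zero q t z k) h3
  refine ⟨R, fun v => ?_, fun x => ?_⟩
  · have hv : R v ∈ (jacobi q t)†.domain := by
      rw [mem_adjoint_domain_iff]
      refine cast (congrArg (Memℓp · 2) (funext fun k => ?_)) (lp.memℓp (v + z • R v))
      exact (hR v k).symm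
    refine ⟨hv, ?_⟩
    ext k
    rw [lp.coeFn_sub, Pi.sub_apply, adjoint_apply_eq_jacobiAction, hR, lp.coeFn_smul,
      Pi.smul_apply, smul_eq_mul]
    ring
  · refine Eq.trans (congrArg (((S⁻¹ : (EllTwo →L[ℂ] EllTwo)ˣ) : EllTwo →L[ℂ] EllTwo)) ?_) (hRS x)
    ext k
    rw [hSv, ← adjoint_apply_eq_jacobiAction]
    rfl

end Resolvent

/-! ### Theta series -/

/-- Triangular numbers indexed by the integers. -/
def tri (k : ℤ) : ℤ := k * (k + 1) / 2

lemma two_mul_tri (k : ℤ) : 2 * tri k = k * (k + 1) :=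
  Int.mul_ediv_cancel' (Int.even_mul_succ_self k).two_dvd

lemma tri_zero : tri 0 = 0 := rfl

lemma tri_add_one (k : ℤ) : tri (k + 1) = tri k + (k + 1) := by
  have h1 := two_mul_tri k
  have h2 := two_mul_tri (k + 1)
  have h3 : 2 * tri (k + 1) = 2 * (tri k + (k + 1)) := by linear_combination h2 - h1
  omega

lemma tri_sub (n k : ℤ) : tri (n - k) = tri n - k * n + tri (-k) := by
  have h1 := two_mul_tri n
  have h2 := two_mul_tri (n - k)
  have h3 := two_mul_tri (-k)
  have h4 : 2 * tri (n - k) = 2 * (tri n - k * n + tri (-k)) := by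
    linear_combination h2 - h1 - h3
  omega

/-- The terms `y^k q^(k(k+1)/2)` of the theta series. -/
def thetaTerm (q : ℝ) (y : ℂ) (k : ℤ) : ℂ := y ^ k * (q : ℂ) ^ tri k

/-- The theta function `∑ y^k q^(k(k+1)/2)`, the sum being over all integers. -/
def theta (q : ℝ) (y : ℂ) : ℂ := ∑' k : ℤ, thetaTerm q y k

/-- The power series `∑ c_n y^n q^(n(n+1)/2)`. -/
def partialTheta (q : ℝ) (c : ℕ → ℂ) (y : ℂ) : ℂ := ∑' n : ℕ, c n * thetaTerm q y n

section Theta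

variable {q : ℝ} {y : ℂ}

lemma thetaTerm_zero (q : ℝ) (y : ℂ) : thetaTerm q y 0 = 1 := by
  simp [thetaTerm, tri_zero]

lemma thetaTerm_ne_zero (hq : 0 < q) (hy : y ≠ 0) (k : ℤ) : thetaTerm q y k ≠ 0 :=
  mul_ne_zero (zpow_ne_zero _ hy) (zpow_ne_zero _ (by exact_mod_cast hq.ne'))

lemma thetaTerm_add_one (hq : 0 < q) (hy : y ≠ 0) (k : ℤ) :
    thetaTerm q y (k + 1) = thetaTerm q y k * (y * (q : ℂ) ^ (k + 1)) := by
  have hq' : (q : ℂ) ≠ 0 := by exact_mod_cast hq.ne'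
  rw [thetaTerm, thetaTerm, tri_add_one, zpow_add₀ hq', zpow_add_one₀ hy]
  ring

lemma thetaTerm_mul (q : ℝ) (x y : ℂ) (k : ℤ) :
    thetaTerm q (y * x) k = x ^ k * thetaTerm q y k := by
  rw [thetaTerm, thetaTerm, mul_zpow]
  ring

/-- Quadratic exponents turn an index shift into a rescaling of `y` by a power of `q`, up to a
factor independent of `n`. -/
lemma thetaTerm_sub (hq : 0 < q) (hy : y ≠ 0) (n k : ℤ) :
    thetaTerm q y (n - k) = thetaTerm q (y * (q : ℂ) ^ (-k)) n * thetaTerm q y (-k) := by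
  have hq' : (q : ℂ) ≠ 0 := by exact_mod_cast hq.ne'
  rw [thetaTerm_mul, ← zpow_mul, thetaTerm, thetaTerm, thetaTerm, tri_sub, sub_eq_add_neg n,
    zpow_add₀ hy, zpow_add₀ hq', sub_eq_add_neg, zpow_add₀ hq', neg_mul]
  ring

lemma tendsto_ofReal_pow (hq : 0 < q) (hq1 : q < 1) :
    Tendsto (fun n : ℕ => (q : ℂ) ^ n) atTop (𝓝 0) :=
  tendsto_pow_atTop_nhds_zero_of_norm_lt_one (by
    rwa [Complex.norm_real, Real.norm_of_nonneg hq.le])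

lemma summable_thetaTerm (hq : 0 < q) (hq1 : q < 1) (hy : y ≠ 0) :
    Summable (thetaTerm q y) := by
  have hq' : (q : ℂ) ≠ 0 := by exact_mod_cast hq.ne'
  have h0 := tendsto_ofReal_pow hq hq1
  refine Summable.of_nat_of_neg ?_ ?_
  · refine summable_of_ratio_test_tendsto_lt_one zero_lt_one
      (Eventually.of_forall fun n => thetaTerm_ne_zero hq hy _) ?_
    have h1 := (((tendsto_add_atTop_iff_nat 1).2 h0).const_mul y).norm
    rw [mul_zero, norm_zero] at h1
    refine h1.congr fun n => ?_
    have hn := norm_ne_zero_iff.2 (thetaTerm_ne_zero hq hy n)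
    rw [Nat.cast_add_one, thetaTerm_add_one hq hy, norm_mul (thetaTerm q y n),
      mul_div_cancel_left₀ _ hn]
    norm_cast
  · refine summable_of_ratio_test_tendsto_lt_one zero_lt_one
      (Eventually.of_forall fun n => thetaTerm_ne_zero hq hy _) ?_
    have h1 := (h0.const_mul y⁻¹).norm
    rw [mul_zero, norm_zero] at h1
    refine h1.congr fun n => ?_
    have h2 := thetaTerm_add_one hq hy (-((n + 1 : ℕ) : ℤ))
    rw [show (-((n + 1 : ℕ) : ℤ)) + 1 = -(n : ℤ) by push_cast; ring] at h2
    have hn := thetaTerm_ne_zero hq hy (-((n + 1 : ℕ) : ℤ))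
    rw [h2, ← norm_div, div_mul_cancel_left₀ hn, mul_inv, zpow_neg, inv_inv, zpow_natCast]

/-! ### Partial theta series: functional equation and asymptotics -/

variable {c : ℕ → ℂ} {C : ℝ}

lemma summable_norm_partialTheta (hq : 0 < q) (hq1 : q < 1) (C : ℝ) (hy : y ≠ 0) :
    Summable fun n : ℕ => C * ‖thetaTerm q y n‖ :=
  ((summable_thetaTerm hq hq1 hy).norm.comp_injective Nat.cast_injective).mul_left C

lemma norm_coeff_mul_le (hc : ∀ n, ‖c n‖ ≤ C) (n : ℕ) :
    ‖c n * thetaTerm q y n‖ ≤ C * ‖thetaTerm q y n‖ := by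
  rw [norm_mul]
  gcongr
  exact hc n

lemma summable_partialTheta (hq : 0 < q) (hq1 : q < 1) (hc : ∀ n, ‖c n‖ ≤ C) (hy : y ≠ 0) :
    Summable fun n : ℕ => c n * thetaTerm q y n :=
  .of_norm_bounded (summable_norm_partialTheta hq hq1 C hy) (norm_coeff_mul_le hc)

/-- The `q`-difference equation of a partial theta series. -/
lemma partialTheta_div (hq : 0 < q) (hq1 : q < 1) (hc : ∀ n, ‖c n‖ ≤ C) (hy : y ≠ 0) {d : ℕ → ℂ}
    (hd : ∀ n, c (n + 1) * (1 - (q : ℂ) ^ (n + 1)) = d n) :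
    partialTheta q c (y / q) - partialTheta q c y = y * partialTheta q d y := by
  have hq' : (q : ℂ) ≠ 0 := by exact_mod_cast hq.ne'
  have hy' : y / q ≠ 0 := div_ne_zero hy hq'
  have s1 := summable_partialTheta hq hq1 hc hy'
  have s2 := summable_partialTheta hq hq1 hc hy
  rw [partialTheta, partialTheta, ← s1.tsum_sub s2, (s1.sub s2).tsum_eq_zero_add, partialTheta,
    ← tsum_mul_left, Nat.cast_zero, thetaTerm_zero, thetaTerm_zero, sub_self, zero_add]
  refine tsum_congr fun n => ?_
  rw [← hd, div_eq_mul_inv, thetaTerm_mul, Nat.cast_add_one, thetaTerm_add_one hq hy,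
    ← Nat.cast_add_one, zpow_natCast, zpow_natCast, inv_pow]
  have := pow_ne_zero (n + 1) hq'
  field_simp

lemma norm_partialTheta_le (hq : 0 < q) (hq1 : q < 1) (hc : ∀ n, ‖c n‖ ≤ C) (hy : y ≠ 0) {x : ℂ}
    (hx : ‖x‖ ≤ 1) : ‖partialTheta q c (y * x)‖ ≤ ∑' n : ℕ, C * ‖thetaTerm q y n‖ := by
  refine tsum_of_norm_bounded (summable_norm_partialTheta hq hq1 C hy).hasSum fun n => ?_
  refine (norm_coeff_mul_le hc n).trans ?_
  have hC : 0 ≤ C := (norm_nonneg _).trans (hc 0)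
  rw [thetaTerm_mul, norm_mul, zpow_natCast, norm_pow]
  gcongr
  exact mul_le_of_le_one_left (norm_nonneg _) (pow_le_one₀ (norm_nonneg _) hx)

lemma tendsto_partialTheta_zero (hq : 0 < q) (hq1 : q < 1) (hc : ∀ n, ‖c n‖ ≤ C) (hy : y ≠ 0) :
    Tendsto (fun k : ℕ => partialTheta q c (y * (q : ℂ) ^ k)) atTop (𝓝 (c 0)) := by
  have hC : 0 ≤ C := (norm_nonneg _).trans (hc 0)
  have h0 := tendsto_ofReal_pow hq hq1
  have h := tendsto_tsum_of_dominated_convergence (𝓕 := (atTop : Filter ℕ))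
    (f := fun k n => c n * thetaTerm q (y * (q : ℂ) ^ k) (n : ℕ))
    (g := fun n : ℕ => if n = 0 then c 0 else 0)
    (summable_norm_partialTheta hq hq1 C hy) (fun n => ?_) (.of_forall fun k n => ?_)
  · rwa [tsum_ite_eq] at h
  · rcases n with _ | n
    · simp [thetaTerm_zero]
    · rw [if_neg n.succ_ne_zero]
      simp_rw [thetaTerm_mul, zpow_natCast]
      have h1 := (((h0.pow (n + 1)).mul_const (thetaTerm q y (n + 1 : ℕ))).const_mul (c (n + 1)))
      simpa using h1
  · refine (norm_coeff_mul_le hc n).trans ?_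
    rw [thetaTerm_mul, norm_mul, zpow_natCast, norm_pow, norm_pow, Complex.norm_real,
      Real.norm_of_nonneg hq.le]
    gcongr
    exact mul_le_of_le_one_left (norm_nonneg _)
      (pow_le_one₀ (by positivity) (pow_le_one₀ hq.le hq1.le))

/-- The growth of a partial theta series along `y q^(-K)` is governed by the theta function. -/
lemma tendsto_partialTheta_mul (hq : 0 < q) (hq1 : q < 1) (hc : ∀ n, ‖c n‖ ≤ C) (hy : y ≠ 0)
    {L : ℂ} (hL : Tendsto c atTop (𝓝 L)) :
    Tendsto (fun K : ℕ => partialTheta q c (y * (q : ℂ) ^ (-(K : ℤ))) * thetaTerm q y (-(K : ℤ)))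
      atTop (𝓝 (L * theta q y)) := by
  have hC : 0 ≤ C := (norm_nonneg _).trans (hc 0)
  -- After the substitution `n = j + K` the sum runs over `j ≥ -K`. Extending the coefficients by
  -- zero makes it a sum over all integers, to which dominated convergence applies.
  let c' : ℤ → ℂ := fun m => if 0 ≤ m then c m.toNat else 0
  have h1 : ∀ K : ℕ, ∑' j : ℤ, c' (j + K) * thetaTerm q y j =
      partialTheta q c (y * (q : ℂ) ^ (-(K : ℤ))) * thetaTerm q y (-(K : ℤ)) := fun K => by
    rw [partialTheta, ← tsum_mul_right,
      ← (Equiv.subRight (K : ℤ)).tsum_eq (fun j => c' (j + K) * thetaTerm q y j)]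
    simp only [Equiv.subRight_apply, sub_add_cancel]
    rw [← (Nat.cast_injective (R := ℤ)).tsum_eq]
    · refine tsum_congr fun n => ?_
      rw [thetaTerm_sub hq hy, ← mul_assoc]
      simp [c']
    · intro j hj
      by_contra h
      refine hj ?_
      have : ¬ 0 ≤ j := fun h0 => h ⟨j.toNat, Int.toNat_of_nonneg h0⟩
      simp [c', this]
  refine Tendsto.congr h1 ?_
  rw [theta, ← tsum_mul_left]
  refine tendsto_tsum_of_dominated_convergence
    ((summable_thetaTerm hq hq1 hy).norm.mul_left C) (fun j => ?_) (.of_forall fun K j => ?_)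
  · refine Tendsto.mul_const _ ?_
    have h2 : Tendsto (fun K : ℕ => (j + K).toNat) atTop atTop := by
      refine tendsto_atTop.2 fun b => ?_
      filter_upwards [eventually_ge_atTop (b + j.natAbs)] with K hK
      omega
    refine (hL.comp h2).congr' ?_
    filter_upwards [eventually_ge_atTop j.natAbs] with K hK
    have : 0 ≤ j + K := by omega
    simp [c', this]
  · rw [norm_mul]
    gcongr
    simp only [c']
    split_ifs
    · exact hc _
    · simpa using hC

/-! ### Infinite products and the zeros of theta -/

lemma exists_tendsto_prod {f : ℕ → ℂ} (hf : Summable fun i => ‖f i‖) :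
    ∃ L, Tendsto (fun n => ∏ i ∈ Finset.range n, (1 + f i)) atTop (𝓝 L) ∧
      ((∀ i, 1 + f i ≠ 0) → L ≠ 0) :=
  ⟨_, (multipliable_one_add_of_summable hf).hasProd.tendsto_prod_nat,
    fun h => tprod_one_add_ne_zero_of_summable h hf⟩

lemma summable_const_mul_pow (hq : 0 < q) (hq1 : q < 1) (a : ℂ) :
    Summable fun i : ℕ => ‖a * (q : ℂ) ^ i‖ := by
  simp_rw [norm_mul, norm_pow, Complex.norm_real, Real.norm_of_nonneg hq.le]
  exact (summable_geometric_of_lt_one hq.le hq1).mul_left _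

/-- The coefficients `∏_{j<n} (1 - a q^j) / (1 - q^(j+1))`. -/
def coeff (q : ℝ) (a : ℂ) (n : ℕ) : ℂ :=
  ∏ j ∈ Finset.range n, (1 - a * (q : ℂ) ^ j) / (1 - (q : ℂ) ^ (j + 1))

lemma one_sub_pow_ne_zero (hq : 0 < q) (hq1 : q < 1) (j : ℕ) : 1 - (q : ℂ) ^ (j + 1) ≠ 0 := by
  have : 1 - q ^ (j + 1) ≠ 0 := (sub_pos.2 (pow_lt_one₀ hq.le hq1 (by omega))).ne'
  exact_mod_cast this

lemma coeff_zero (q : ℝ) (a : ℂ) : coeff q a 0 = 1 := by simp [coeff]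

lemma coeff_succ (hq : 0 < q) (hq1 : q < 1) (a : ℂ) (n : ℕ) :
    coeff q a (n + 1) * (1 - (q : ℂ) ^ (n + 1)) = coeff q a n * (1 - a * (q : ℂ) ^ n) := by
  have := one_sub_pow_ne_zero hq hq1 n
  rw [coeff, Finset.prod_range_succ, coeff]
  field_simp

/-- The limit is the quotient `(a; q)_∞ / (q; q)_∞` of absolutely convergent products, which are
nonzero when all their factors are. -/
lemma exists_tendsto_coeff (hq : 0 < q) (hq1 : q < 1) (a : ℂ) :
    ∃ L, Tendsto (coeff q a) atTop (𝓝 L) ∧ ((∀ n : ℕ, a * (q : ℂ) ^ n ≠ 1) → L ≠ 0) := by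
  obtain ⟨L1, h1, h1'⟩ := exists_tendsto_prod (summable_const_mul_pow hq hq1 (-a))
  obtain ⟨L2, h2, h2'⟩ := exists_tendsto_prod (summable_const_mul_pow hq hq1 (-(q : ℂ)))
  have h3 : L2 ≠ 0 := h2' fun i => by
    have := one_sub_pow_ne_zero hq hq1 i
    rwa [pow_succ', sub_eq_add_neg, ← neg_mul] at this
  refine ⟨L1 / L2, (h1.div h2 h3).congr fun n => ?_, fun h => div_ne_zero (h1' fun i => ?_) h3⟩
  · rw [Pi.div_apply, ← Finset.prod_div_distrib, coeff]
    refine Finset.prod_congr rfl fun j _ => ?_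
    rw [pow_succ', sub_eq_add_neg, sub_eq_add_neg, neg_mul, neg_mul]
  · rw [neg_mul, ← sub_eq_add_neg]
    exact sub_ne_zero.2 (h i).symm

lemma exists_norm_coeff_le (hq : 0 < q) (hq1 : q < 1) (a : ℂ) : ∃ C, ∀ n, ‖coeff q a n‖ ≤ C := by
  obtain ⟨L, hL, -⟩ := exists_tendsto_coeff hq hq1 a
  obtain ⟨C, hC⟩ := hL.norm.bddAbove_range
  exact ⟨C, fun n => hC ⟨n, rfl⟩⟩

/-- The theta function vanishes at most at the points `-q^r`. This is the part of the Jacobi triple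
product identity that locates the zeros; it follows from the product formula for
`∑ y^n q^(n(n+1)/2) / (q; q)_n`. -/
theorem theta_ne_zero (hq : 0 < q) (hq1 : q < 1) (hy : y ≠ 0)
    (h : ∀ r : ℤ, y ≠ -(q : ℂ) ^ r) : theta q y ≠ 0 := by
  have hq' : (q : ℂ) ≠ 0 := by exact_mod_cast hq.ne'
  obtain ⟨C, hC⟩ := exists_norm_coeff_le hq hq1 0
  obtain ⟨L, hL, -⟩ := exists_tendsto_coeff hq hq1 0
  -- Iterating this equation towards the origin evaluates the series at `y` as the product `P`;
  -- iterating it outwards produces the partial products of `Q`.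
  have hE : ∀ {x : ℂ}, x ≠ 0 → partialTheta q (coeff q 0) (x / q) =
      (1 + x) * partialTheta q (coeff q 0) x := fun {x} hx => by
    have := partialTheta_div hq hq1 hC hx (d := coeff q 0) fun n => by
      rw [coeff_succ hq hq1, zero_mul, sub_zero, mul_one]
    linear_combination this
  obtain ⟨P, hP, hP0⟩ := exists_tendsto_prod (summable_const_mul_pow hq hq1 (y * q))
  obtain ⟨Q, hQ, hQ0⟩ := exists_tendsto_prod (summable_const_mul_pow hq hq1 y⁻¹)
  have hprod : ∀ n : ℕ, partialTheta q (coeff q 0) y =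
      (∏ i ∈ Finset.range n, (1 + y * q * (q : ℂ) ^ i)) *
        partialTheta q (coeff q 0) (y * (q : ℂ) ^ n) := fun n => by
    induction n with
    | zero => simp
    | succ n ih =>
      have h1 := hE (x := y * (q : ℂ) ^ (n + 1)) (mul_ne_zero hy (pow_ne_zero _ hq'))
      rw [show y * (q : ℂ) ^ (n + 1) / q = y * (q : ℂ) ^ n by
        rw [pow_succ]; field_simp] at h1
      rw [ih, h1, Finset.prod_range_succ]
      ring
  have hEy : partialTheta q (coeff q 0) y = P := by
    have h1 := hP.mul (tendsto_partialTheta_zero hq hq1 hC hy)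
    rw [coeff_zero, mul_one] at h1
    exact tendsto_nhds_unique (tendsto_const_nhds.congr hprod) h1
  have hgrowth : ∀ K : ℕ, partialTheta q (coeff q 0) (y * (q : ℂ) ^ (-(K : ℤ))) *
      thetaTerm q y (-(K : ℤ)) = P * ∏ i ∈ Finset.range K, (1 + y⁻¹ * (q : ℂ) ^ i) := fun K => by
    induction K with
    | zero => simp [thetaTerm_zero, hEy]
    | succ K ih =>
      have hx : y * (q : ℂ) ^ (-(K : ℤ)) ≠ 0 := mul_ne_zero hy (zpow_ne_zero _ hq')
      have h1 := hE hx
      have h2 := thetaTerm_add_one hq hy (-((K + 1 : ℕ) : ℤ))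
      rw [show (-((K + 1 : ℕ) : ℤ)) + 1 = -(K : ℤ) by push_cast; ring] at h2
      have h3 : y * (q : ℂ) ^ (-(K : ℤ)) / q = y * (q : ℂ) ^ (-((K + 1 : ℕ) : ℤ)) := by
        rw [Nat.cast_add_one, neg_add, ← sub_eq_add_neg, zpow_sub_one₀ hq']
        ring
      have h4 : y⁻¹ * (q : ℂ) ^ K = (y * (q : ℂ) ^ (-(K : ℤ)))⁻¹ := by
        rw [mul_inv, zpow_neg, inv_inv, zpow_natCast]
      rw [Finset.prod_range_succ, ← mul_assoc, ← ih, ← h3, h1, h2, h4]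
      field_simp
      ring
  -- The same growth has limit `L * theta q y`, hence `L * theta q y = P * Q`.
  have hlim := tendsto_partialTheta_mul hq hq1 hC hy hL
  simp_rw [hgrowth] at hlim
  have hPQ := tendsto_nhds_unique hlim (hQ.const_mul P)
  refine right_ne_zero_of_mul (a := L) ?_
  rw [hPQ]
  refine mul_ne_zero (hP0 fun i hi => h (-(i + 1 : ℤ)) ?_) (hQ0 fun i hi => h i ?_)
  · have h5 : y * (q : ℂ) ^ (i + 1) = -1 := by linear_combination hi
    rw [zpow_neg, ← Nat.cast_add_one, zpow_natCast, ← one_div, eq_comm, ← neg_div,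
      div_eq_iff (pow_ne_zero _ hq'), h5]
  · rw [zpow_natCast]
    field_simp at hi
    linear_combination hi

end Theta

/-! ### The eigenfunctions -/

/-- A solution of a second order recurrence which vanishes at two consecutive points is zero. -/
lemma eq_zero_of_recurrence {α β γ v : ℤ → ℂ} (hα : ∀ k, α k ≠ 0) (hγ : ∀ k, γ k ≠ 0)
    (hv : ∀ k, α k * v (k + 1) + β k * v k + γ k * v (k - 1) = 0) {j : ℤ} (h0 : v j = 0)
    (h1 : v (j + 1) = 0) (k : ℤ) : v k = 0 := by
  suffices h : v k = 0 ∧ v (k + 1) = 0 from h.1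
  induction k using Int.inductionOn' (b := j) with
  | zero => exact ⟨h0, h1⟩
  | succ k _ ih =>
    refine ⟨ih.2, ?_⟩
    have h := hv (k + 1)
    rw [add_sub_cancel_right, ih.1, ih.2] at h
    exact (mul_eq_zero.1 (by simpa using h)).resolve_left (hα _)
  | pred k _ ih =>
    have h := hv k
    rw [ih.1, ih.2] at h
    rw [sub_add_cancel]
    exact ⟨(mul_eq_zero.1 (by simpa using h)).resolve_left (hγ _), ih.1⟩

/-- The weights `m_k = t^k q^(k(k+1)/2)`. -/
def weight (q t : ℝ) (k : ℤ) : ℝ := t ^ k * q ^ tri k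

/-- The solution of `L f = z f` that is regular at the origin. -/
def eigenFun (q : ℝ) (z : ℂ) (x : ℝ) : ℂ := partialTheta q (coeff q z⁻¹) (z * x)

/-- The solution of `J u = z u` that is square summable at `+∞`. -/
def eigenSeq (q t : ℝ) (z : ℂ) (k : ℤ) : ℂ := eigenFun q z (t * q ^ k) * (√(weight q t k) : ℝ)

section Eigenvectors

variable {q t : ℝ} {z : ℂ}

lemma weight_pos (hq : 0 < q) (ht : 0 < t) (k : ℤ) : 0 < weight q t k := by
  unfold weight; positivity

lemma weight_add_one (hq : 0 < q) (ht : 0 < t) (k : ℤ) :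
    weight q t (k + 1) = t * q ^ (k + 1) * weight q t k := by
  rw [weight, weight, tri_add_one, zpow_add₀ hq.ne' (tri k), zpow_add_one₀ ht.ne']
  ring

lemma norm_thetaTerm (hq : 0 < q) (y : ℂ) (k : ℤ) : ‖thetaTerm q y k‖ = weight q ‖y‖ k := by
  rw [thetaTerm, norm_mul, norm_zpow, norm_zpow, Complex.norm_real, Real.norm_of_nonneg hq.le,
    weight]

lemma summable_weight (hq : 0 < q) (hq1 : q < 1) (ht : 0 < t) : Summable (weight q t) := by
  have h := (summable_thetaTerm hq hq1 (y := t) (by exact_mod_cast ht.ne')).norm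
  simp_rw [norm_thetaTerm hq, Complex.norm_real, Real.norm_of_nonneg ht.le] at h
  exact h

lemma weight_mul (x : ℝ) (k : ℤ) : weight q (t * x) k = x ^ k * weight q t k := by
  rw [weight, weight, mul_zpow]
  ring

/-- In the coefficient recursion the factor `1 - z⁻¹ q^n` splits into a multiple of `f(x)` and one
of `f(xq)`, because `q^n` rescales the argument by `q`. -/
lemma qDifference_eigenFun (hq : 0 < q) (hq1 : q < 1) (hz : z ≠ 0) {x : ℝ} (hx : x ≠ 0) :
    qDifference q (eigenFun q z) x = z * eigenFun q z x := by
  obtain ⟨C, hC⟩ := exists_norm_coeff_le hq hq1 z⁻¹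
  have hq' : (q : ℂ) ≠ 0 := by exact_mod_cast hq.ne'
  have hx' : (x : ℂ) ≠ 0 := by exact_mod_cast hx
  have hy : z * x ≠ 0 := mul_ne_zero hz hx'
  have h1 := partialTheta_div hq hq1 hC hy (fun n => coeff_succ hq hq1 z⁻¹ n)
  have h2 : partialTheta q (fun n => coeff q z⁻¹ n * (1 - z⁻¹ * (q : ℂ) ^ n)) (z * x) =
      partialTheta q (coeff q z⁻¹) (z * x) - z⁻¹ * partialTheta q (coeff q z⁻¹) (z * x * q) := by
    rw [partialTheta, partialTheta, partialTheta, ← tsum_mul_left,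
      ← (summable_partialTheta hq hq1 hC hy).tsum_sub
        ((summable_partialTheta hq hq1 hC (mul_ne_zero hy hq')).mul_left _)]
    refine tsum_congr fun n => ?_
    rw [thetaTerm_mul q q (z * x), zpow_natCast]
    ring
  rw [h2] at h1
  simp only [qDifference, eigenFun]
  push_cast
  rw [← mul_assoc, ← mul_div_assoc]
  field_simp at h1 ⊢
  linear_combination h1

lemma jacobiAction_eigenSeq (hq : 0 < q) (hq1 : q < 1) (ht : 0 < t) (hz : z ≠ 0) (k : ℤ) :
    jacobiAction q t (eigenSeq q t z) k = z * eigenSeq q t z k := by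
  have h := jacobiAction_conj q t hq ht (weight q t) (weight_add_one hq ht) (eigenFun q z) k
  rw [qDifference_eigenFun hq hq1 hz (by positivity)] at h
  rw [eigenSeq, ← mul_assoc, ← h]
  rfl

lemma exists_norm_eigenFun_le (hq : 0 < q) (hq1 : q < 1) (ht : 0 < t) (hz : z ≠ 0) (r : ℤ) :
    ∃ B, 0 ≤ B ∧ ∀ k, r ≤ k → ‖eigenFun q z (t * q ^ k)‖ ≤ B := by
  obtain ⟨C, hC⟩ := exists_norm_coeff_le hq hq1 z⁻¹
  have hq' : (q : ℂ) ≠ 0 := by exact_mod_cast hq.ne'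
  have ht' : (t : ℂ) ≠ 0 := by exact_mod_cast ht.ne'
  have h : ∀ k, r ≤ k → ‖eigenFun q z (t * q ^ k)‖ ≤
      ∑' n : ℕ, C * ‖thetaTerm q (z * t * (q : ℂ) ^ r) n‖ := fun k hk => by
    have h1 := norm_partialTheta_le hq hq1 hC (y := z * t * (q : ℂ) ^ r)
      (mul_ne_zero (mul_ne_zero hz ht') (zpow_ne_zero _ hq')) (x := (q : ℂ) ^ (k - r)) (by
        rw [norm_zpow, Complex.norm_real, Real.norm_of_nonneg hq.le]
        exact zpow_le_one₀ hq hq1.le (by omega))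
    rw [mul_assoc _ ((q : ℂ) ^ r), ← zpow_add₀ hq', add_sub_cancel, mul_assoc z] at h1
    rw [eigenFun]
    push_cast
    exact h1
  exact ⟨_, (norm_nonneg _).trans (h r le_rfl), h⟩

/-- The eigenfunction tends to `coeff q z⁻¹ 0 = 1` along the lattice points approaching the origin.
-/
lemma eigenSeq_ne_zero (hq : 0 < q) (hq1 : q < 1) (ht : 0 < t) (hz : z ≠ 0) :
    ∃ k, eigenSeq q t z k ≠ 0 := by
  by_contra! h
  obtain ⟨C, hC⟩ := exists_norm_coeff_le hq hq1 z⁻¹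
  have ht' : (t : ℂ) ≠ 0 := by exact_mod_cast ht.ne'
  have h1 := tendsto_partialTheta_zero hq hq1 hC (mul_ne_zero hz ht')
  rw [coeff_zero] at h1
  refine one_ne_zero (tendsto_nhds_unique h1 (tendsto_const_nhds.congr fun k => ?_))
  have h2 : (√(weight q t k) : ℂ) ≠ 0 := by
    exact_mod_cast (Real.sqrt_pos.2 (weight_pos hq ht k)).ne'
  have h3 := (mul_eq_zero.1 (h k)).resolve_right h2
  rw [eigenFun, zpow_natCast] at h3
  push_cast at h3
  rw [mul_assoc, h3]

lemma norm_eigenSeq_sq (hq : 0 < q) (ht : 0 < t) (k : ℤ) :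
    ‖eigenSeq q t z k‖ ^ 2 = ‖eigenFun q z (t * q ^ k)‖ ^ 2 * weight q t k := by
  rw [eigenSeq, norm_mul, mul_pow, Complex.norm_real, Real.norm_of_nonneg (Real.sqrt_nonneg _),
    Real.sq_sqrt (weight_pos hq ht k).le]

/-- At `z = q^n` the eigenfunction is a polynomial of degree `n`. -/
lemma memℓp_eigenSeq_pow (hq : 0 < q) (hq1 : q < 1) (ht : 0 < t) (n : ℕ) :
    Memℓp (eigenSeq q t ((q : ℂ) ^ n)) 2 := by
  have hq' : (q : ℂ) ≠ 0 := by exact_mod_cast hq.ne'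
  have h0 : ∀ m : ℕ, m ∉ Finset.range (n + 1) → coeff q ((q : ℂ) ^ n)⁻¹ m = 0 := fun m hm => by
    refine Finset.prod_eq_zero (i := n) (Finset.mem_range.2 ?_) ?_
    · rw [Finset.mem_range] at hm; omega
    · rw [inv_mul_cancel₀ (pow_ne_zero n hq'), sub_self, zero_div]
  have h1 : ∀ m : ℕ, Memℓp (fun k : ℤ => (coeff q ((q : ℂ) ^ n)⁻¹ m *
      thetaTerm q ((q : ℂ) ^ n * t) m) * (((q : ℂ) ^ k) ^ m * (√(weight q t k) : ℝ))) 2 := by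
    intro m
    refine Memℓp.const_mul ?_ _
    rw [memℓp_two_iff]
    -- The squared monomial `q^(2mk)` is absorbed into the weight by changing its parameter `t`.
    refine (summable_weight hq hq1 (t := t * q ^ (2 * m)) (by positivity)).congr fun k => ?_
    rw [weight_mul, norm_mul, mul_pow, Complex.norm_real, Real.norm_of_nonneg (Real.sqrt_nonneg _),
      Real.sq_sqrt (weight_pos hq ht k).le, norm_pow, norm_zpow, Complex.norm_real,
      Real.norm_of_nonneg hq.le, ← pow_mul, mul_comm m 2, ← zpow_natCast, ← zpow_natCast, ← zpow_mul,
      ← zpow_mul, mul_comm k]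
  refine cast (congrArg (Memℓp · 2) (funext fun k => ?_))
    (Memℓp.finsetSum (Finset.range (n + 1)) fun m _ => h1 m)
  rw [eigenSeq, eigenFun, partialTheta, tsum_eq_sum fun m hm => by rw [h0 m hm, zero_mul],
    Finset.sum_mul]
  refine Finset.sum_congr rfl fun m _ => ?_
  push_cast
  rw [← mul_assoc ((q : ℂ) ^ n), thetaTerm_mul q ((q : ℂ) ^ k) ((q : ℂ) ^ n * t), zpow_natCast]
  ring

/-- At `z = -q^r/t` the eigenfunction has a reflection symmetry on the lattice. -/
lemma eigenFun_reflection (hq : 0 < q) (hq1 : q < 1) (ht : 0 < t) (r k : ℤ)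
    (hz : z = -(q : ℂ) ^ r / t) :
    eigenFun q z (t * q ^ k) = z ^ (k + r) * eigenFun q z (t * q ^ (-2 * r - k)) := by
  have hq' : (q : ℂ) ≠ 0 := by exact_mod_cast hq.ne'
  have ht' : (t : ℂ) ≠ 0 := by exact_mod_cast ht.ne'
  have hz0 : z ≠ 0 := by
    rw [hz]
    exact div_ne_zero (neg_ne_zero.2 (zpow_ne_zero _ hq')) ht'
  set F : ℤ → ℂ := fun k => eigenFun q z (t * q ^ k) with hF
  have hrec : ∀ k, (t * (q : ℂ) ^ k) * F (k + 1) - F k + F (k - 1) =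
      z * (t * (q : ℂ) ^ k) * F k := fun k => by
    have h := qDifference_eigenFun hq hq1 hz0 (x := t * q ^ k) (by positivity)
    rw [qDifference, mul_assoc t, ← zpow_add_one₀ hq.ne', mul_div_assoc t, div_eq_mul_inv (q ^ k),
      ← zpow_sub_one₀ hq.ne'] at h
    have hqk := zpow_ne_zero k hq'
    push_cast at h
    field_simp at h
    simp only [hF]
    linear_combination h
  rw [← sub_eq_zero]
  -- Both sides solve the same second order recurrence, so it suffices to compare them at the centre
  -- `-r` of the reflection and at `-r + 1`.
  refine eq_zero_of_recurrence (α := fun k => t * (q : ℂ) ^ k)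
    (β := fun k => -1 - z * (t * (q : ℂ) ^ k)) (γ := fun _ => 1)
    (v := fun k => F k - z ^ (k + r) * F (-2 * r - k)) (j := -r)
    (fun k => mul_ne_zero ht' (zpow_ne_zero _ hq')) (fun _ => one_ne_zero) (fun k => ?_) ?_ ?_ k
  · have h1 := hrec k
    have h2 := hrec (-2 * r - k)
    -- This relation between a lattice point and its mirror image makes the reflected recurrence,
    -- twisted by `z^(k+r)`, coincide with the original.
    have h3 : z ^ 2 * (t * (q : ℂ) ^ (-2 * r - k)) * (t * (q : ℂ) ^ k) = 1 := by
      have h4 : (q : ℂ) ^ (-2 * r - k) = ((q : ℂ) ^ r)⁻¹ * ((q : ℂ) ^ r)⁻¹ * ((q : ℂ) ^ k)⁻¹ := by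
        rw [← zpow_neg, ← zpow_neg, ← zpow_add₀ hq', ← zpow_add₀ hq']
        congr 1
        ring
      rw [h4, hz]
      have h5 := zpow_ne_zero r hq'
      have h6 := zpow_ne_zero k hq'
      field_simp
    rw [show -2 * r - (k + 1) = -2 * r - k - 1 by ring,
      show -2 * r - (k - 1) = -2 * r - k + 1 by ring, show k + 1 + r = k + r + 1 by ring,
      show k - 1 + r = k + r - 1 by ring, zpow_add_one₀ hz0, zpow_sub_one₀ hz0]
    set X := (t : ℂ) * (q : ℂ) ^ k
    set X' := (t : ℂ) * (q : ℂ) ^ (-2 * r - k)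
    have h4 : z⁻¹ = z * X' * X := by
      field_simp
      linear_combination -h3
    rw [h4]
    linear_combination h1 - z ^ (k + r) * z * X * h2
      - z ^ (k + r) * F (-2 * r - k) * h3
  · rw [neg_add_cancel, zpow_zero, one_mul, show -2 * r - -r = -r by ring, sub_self]
  · have h1 := hrec (-r)
    have h2 : (t * (q : ℂ) ^ (-r)) * z = -1 := by
      rw [hz, zpow_neg]
      have := zpow_ne_zero r hq'
      field_simp
    rw [show -r + 1 + r = 1 by ring, zpow_one, show -2 * r - (-r + 1) = -r - 1 by ring]
    linear_combination -z * h1 + (F (-r + 1) - z * F (-r)) * h2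

lemma memℓp_eigenSeq_neg (hq : 0 < q) (hq1 : q < 1) (ht : 0 < t) (r : ℤ)
    (hz : z = -(q : ℂ) ^ r / t) : Memℓp (eigenSeq q t z) 2 := by
  have hq' : (q : ℂ) ≠ 0 := by exact_mod_cast hq.ne'
  have ht' : (t : ℂ) ≠ 0 := by exact_mod_cast ht.ne'
  have hz0 : z ≠ 0 := by
    rw [hz]
    exact div_ne_zero (neg_ne_zero.2 (zpow_ne_zero _ hq')) ht'
  have hz1 : 0 < ‖z‖ := norm_pos_iff.2 hz0
  obtain ⟨B, hB, hBk⟩ := exists_norm_eigenFun_le hq hq1 ht hz0 (-r)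
  rw [memℓp_two_iff]
  -- The first majorant serves `k ≥ -r`. The second serves `k ≤ -r`, where the mirror image is at
  -- least `-r` and the factor `‖z‖^(2k)` changes the weight parameter to `t ‖z‖^2`.
  have hs := ((summable_weight hq hq1 ht).mul_left (B ^ 2)).add
    ((summable_weight hq hq1 (t := t * ‖z‖ ^ 2) (by positivity)).mul_left
      ((‖z‖ ^ r) ^ 2 * B ^ 2))
  refine Summable.of_nonneg_of_le (fun k => by positivity) (fun k => ?_) hs
  rw [norm_eigenSeq_sq hq ht, weight_mul]
  have hw := weight_pos hq ht k
  rcases le_total (-r) k with hk | hk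
  · have h1 := hBk k hk
    have : 0 ≤ (‖z‖ ^ r) ^ 2 * B ^ 2 * ((‖z‖ ^ 2) ^ k * weight q t k) := by positivity
    refine le_add_of_le_of_nonneg ?_ this
    gcongr
  · have h1 := hBk (-2 * r - k) (by omega)
    refine le_add_of_nonneg_of_le (by positivity) ?_
    rw [eigenFun_reflection hq hq1 ht r k hz, norm_mul, norm_zpow, zpow_add₀ hz1.ne']
    have h2 : (‖z‖ ^ 2) ^ k = (‖z‖ ^ k) ^ 2 := by
      rw [← zpow_natCast, ← zpow_natCast, ← zpow_mul, ← zpow_mul, mul_comm]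
    rw [h2]
    calc _ ≤ (‖z‖ ^ k * ‖z‖ ^ r * B) ^ 2 * weight q t k := by gcongr
      _ = _ := by ring

end Eigenvectors

/-! ### Absence of other eigenvalues -/

section NoEigenvector

variable {q t : ℝ} {z : ℂ}

/-- A solution of `J u = z u` which vanishes at two consecutive points is zero. -/
lemma eq_zero_of_jacobiAction (hq : 0 < q) (ht : 0 < t) {u : ℤ → ℂ}
    (hu : ∀ k, jacobiAction q t u k = z * u k) {j : ℤ} (h0 : u j = 0) (h1 : u (j + 1) = 0)
    (k : ℤ) : u k = 0 := by
  have ha : ∀ k, (offDiag q t k : ℂ) ≠ 0 := fun k => by exact_mod_cast (offDiag_pos hq ht k).ne'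
  refine eq_zero_of_recurrence (α := fun k => (offDiag q t k : ℂ))
    (β := fun k => (diag q t k : ℂ) - z) (γ := fun k => (offDiag q t (k - 1) : ℂ)) ha
    (fun k => ha _) (fun k => ?_) h0 h1 k
  have := hu k
  rw [jacobiAction] at this
  linear_combination this

/-- The discrete counterpart of the constancy of the Wronskian. -/
lemma casoratian_eq (q t : ℝ) {u v : ℤ → ℂ} (hu : ∀ k, jacobiAction q t u k = z * u k)
    (hv : ∀ k, jacobiAction q t v k = z * v k) (j k : ℤ) :
    (offDiag q t j : ℂ) * (u (j + 1) * v j - u j * v (j + 1)) =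
      offDiag q t k * (u (k + 1) * v k - u k * v (k + 1)) := by
  have hstep : ∀ k : ℤ, (offDiag q t (k + 1) : ℂ) * (u (k + 1 + 1) * v (k + 1)
      - u (k + 1) * v (k + 1 + 1)) = offDiag q t k * (u (k + 1) * v k - u k * v (k + 1)) :=
    fun k => by
      have h1 := hu (k + 1)
      have h2 := hv (k + 1)
      rw [jacobiAction, add_sub_cancel_right] at h1 h2
      linear_combination v (k + 1) * h1 - u (k + 1) * h2
  induction j using Int.inductionOn' (b := k) with
  | zero => rfl
  | succ j _ ih => rw [hstep, ih]
  | pred j _ ih => rw [← ih, ← hstep (j - 1), sub_add_cancel]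

lemma tendsto_weight_cofinite (hq : 0 < q) (hq1 : q < 1) (ht : 0 < t) :
    Tendsto (weight q t) cofinite (𝓝 0) :=
  (summable_weight hq hq1 ht).tendsto_cofinite_zero

lemma tendsto_eigenSeq_atTop (hq : 0 < q) (hq1 : q < 1) (ht : 0 < t) (hz : z ≠ 0) :
    Tendsto (eigenSeq q t z) atTop (𝓝 0) := by
  obtain ⟨B, hB, hBk⟩ := exists_norm_eigenFun_le hq hq1 ht hz 0
  have h1 := (((tendsto_weight_cofinite hq hq1 ht).mono_left atTop_le_cofinite_int).sqrt).const_mul B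
  rw [Real.sqrt_zero, mul_zero] at h1
  refine squeeze_zero_norm' ?_ h1
  filter_upwards [eventually_ge_atTop 0] with k hk
  rw [eigenSeq, norm_mul, Complex.norm_real, Real.norm_of_nonneg (Real.sqrt_nonneg _)]
  gcongr
  exact hBk k hk

/-- An eigenvector is proportional to the solution that is regular at `+∞`. -/
lemma mul_eigenSeq_comm (hq : 0 < q) (hq1 : q < 1) (ht : 0 < t) (hz : z ≠ 0) {u : EllTwo}
    (hu : ∀ k, jacobiAction q t u k = z * u k) (j k : ℤ) :
    u j * eigenSeq q t z k = u k * eigenSeq q t z j := by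
  have hφ := jacobiAction_eigenSeq hq hq1 ht hz
  have hw : Memℓp (jacobiAction q t u) 2 := by
    refine cast (congrArg (Memℓp · 2) (funext fun k => ?_)) ((lp.memℓp u).const_mul z)
    exact (hu k).symm
  have h0 := (tendsto_cofinite_of_memℓp_two
    (memℓp_offDiag_mul hq hq1 ht (lp.memℓp u) hw)).mono_left atTop_le_cofinite_int
  have hs : Tendsto (fun k : ℤ => k + 1) atTop atTop :=
    tendsto_atTop_add_const_right _ 1 tendsto_id
  have h1 := tendsto_eigenSeq_atTop hq hq1 ht hz
  -- Although `a_k` is unbounded here, `a_k u_k → 0` on the maximal domain, and the regular solution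
  -- tends to zero as well.
  have h2 : Tendsto (fun k => (offDiag q t k : ℂ) *
      (u (k + 1) * eigenSeq q t z k - u k * eigenSeq q t z (k + 1))) atTop (𝓝 0) := by
    have h3 := (((h0.comp hs).mul h1).const_mul (√q : ℂ)).sub (h0.mul (h1.comp hs))
    rw [mul_zero, mul_zero, sub_zero] at h3
    refine h3.congr fun k => ?_
    have h4 := offDiag_sub_one hq ht (k + 1)
    rw [add_sub_cancel_right] at h4
    simp only [Function.comp_apply]
    rw [h4]
    push_cast
    ring
  have h3 : ∀ j, u (j + 1) * eigenSeq q t z j - u j * eigenSeq q t z (j + 1) = 0 := fun j => by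
    have h4 := tendsto_nhds_unique (tendsto_const_nhds.congr fun k => casoratian_eq q t hu hφ j k) h2
    exact (mul_eq_zero.1 h4).resolve_left (by exact_mod_cast (offDiag_pos hq ht j).ne')
  rw [← sub_eq_zero]
  refine eq_zero_of_jacobiAction (z := z) hq ht
    (u := fun k => u j * eigenSeq q t z k - u k * eigenSeq q t z j) (j := j)
    (fun k => ?_) (sub_self _) ?_ k
  · have h4 := hu k
    have h5 := hφ k
    rw [jacobiAction] at h4 h5 ⊢
    linear_combination u j * h5 - eigenSeq q t z j * h4
  · linear_combination -h3 j

theorem eq_zero_of_jacobiAction_eq (hq : 0 < q) (hq1 : q < 1) (ht : 0 < t) (hz : z ≠ 0)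
    (h1 : ∀ n : ℕ, z ≠ (q : ℂ) ^ n) (h2 : ∀ r : ℤ, z ≠ -(q : ℂ) ^ r / t) {u : EllTwo}
    (hu : ∀ k, jacobiAction q t u k = z * u k) : u = 0 := by
  have ht' : (t : ℂ) ≠ 0 := by exact_mod_cast ht.ne'
  have hy : z * t ≠ 0 := mul_ne_zero hz ht'
  obtain ⟨C, hC⟩ := exists_norm_coeff_le hq hq1 z⁻¹
  obtain ⟨L, hL, hL0⟩ := exists_tendsto_coeff hq hq1 z⁻¹
  have hlim := tendsto_partialTheta_mul hq hq1 hC hy hL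
  have hne : L * theta q (z * t) ≠ 0 := by
    refine mul_ne_zero (hL0 fun n hn => h1 n ?_) (theta_ne_zero hq hq1 hy fun r hr => h2 r ?_)
    · field_simp at hn
      exact hn.symm
    · rw [eq_div_iff ht', hr]
  have hneg : Tendsto (fun K : ℕ => -(K : ℤ)) atTop cofinite :=
    (tendsto_neg_atTop_atBot.comp tendsto_natCast_atTop_atTop).mono_right atBot_le_cofinite_int
  -- In norm this quotient is the square root of a weight with parameter `‖z t‖^2 / t`. Its decay
  -- shows that the regular solution is unbounded at `-∞` when its leading coefficient is nonzero.
  have hR : Tendsto (fun K : ℕ => thetaTerm q (z * t) (-(K : ℤ)) /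
      (√(weight q t (-(K : ℤ))) : ℝ)) atTop (𝓝 0) := by
    have hρ : 0 < ‖z * t‖ := norm_pos_iff.2 hy
    have h3 := ((tendsto_weight_cofinite hq hq1 (t := ‖z * t‖ ^ 2 / t) (by positivity)).comp
      hneg).sqrt
    rw [Real.sqrt_zero] at h3
    rw [tendsto_zero_iff_norm_tendsto_zero]
    refine h3.congr fun K => ?_
    have hw := weight_pos hq ht (-(K : ℤ))
    rw [Function.comp_apply, norm_div, norm_thetaTerm hq, Complex.norm_real, Real.norm_of_nonneg (Real.sqrt_nonneg _),
      Real.sqrt_eq_iff_eq_sq (weight_pos hq (by positivity) _).le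
        (div_nonneg (weight_pos hq hρ _).le (Real.sqrt_nonneg _)),
      div_pow, Real.sq_sqrt hw.le]
    have h5 : (‖z * t‖ ^ 2) ^ (-(K : ℤ)) = (‖z * t‖ ^ (-(K : ℤ))) ^ 2 := by
      rw [← zpow_natCast, ← zpow_natCast, ← zpow_mul, ← zpow_mul, mul_comm ((2 : ℕ) : ℤ)]
    rw [weight, weight, weight, div_zpow, h5]
    have := zpow_ne_zero (-(K : ℤ)) ht.ne'
    have := zpow_ne_zero (tri (-(K : ℤ))) hq.ne'
    field_simp
  have hu0 := (tendsto_cofinite_of_memℓp_two (lp.memℓp u)).comp hneg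
  ext j
  have h3 := (hu0.mul_const (eigenSeq q t z j)).mul hR
  rw [zero_mul, zero_mul] at h3
  have h4 := hlim.const_mul (u j)
  have h5 := tendsto_nhds_unique (h4.congr fun K => ?_) h3
  · exact (mul_eq_zero.1 h5).resolve_right hne
  · have h6 := mul_eigenSeq_comm hq hq1 ht hz hu j (-(K : ℤ))
    have h7 : ((√(weight q t (-(K : ℤ))) : ℝ) : ℂ) ≠ 0 := by
      exact_mod_cast (Real.sqrt_pos.2 (weight_pos hq ht _)).ne'
    rw [Function.comp_apply, ← h6, eigenSeq, eigenFun]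
    push_cast
    rw [← mul_assoc z]
    field_simp

/-- At `z = 0` all solutions grow at `-∞`. -/
theorem eq_zero_of_jacobiAction_eq_zero (hq : 0 < q) (hq1 : q < 1) (ht : 0 < t) {u : EllTwo}
    (hu : ∀ k, jacobiAction q t u k = 0) : u = 0 := by
  set σ := √q with hσ
  have hσ0 : 0 < σ := Real.sqrt_pos.2 hq
  have hσ1 : σ < 1 := by rw [hσ, Real.sqrt_lt' one_pos]; simpa using hq1
  -- Near `-∞` the equation is close to `√q u_(k-1) = -u_(k+1)`, a growth factor `q^(-1/2)` over two
  -- steps. The weight `τ = q^(1/4)` balances the two parities, and the resulting slack `τ (1 - τ)`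
  -- absorbs the term with `a_k`.
  set τ := √σ with hτ
  have hτ0 : 0 < τ := Real.sqrt_pos.2 hσ0
  have hτ1 : τ < 1 := by rw [hτ, Real.sqrt_lt' one_pos]; simpa using hσ1
  have hτσ : τ * τ = σ := Real.mul_self_sqrt hσ0.le
  have hrec : ∀ k, (σ : ℂ) * u (k - 1) = (q * offDiag q t k : ℝ) * u k - u (k + 1) := fun k => by
    have h := hu k
    have ha : (offDiag q t k : ℂ) ≠ 0 := by exact_mod_cast (offDiag_pos hq ht k).ne'
    rw [jacobiAction, offDiag_sub_one hq ht, diag_eq hq ht] at h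
    push_cast at h ⊢
    refine mul_left_cancel₀ ha ?_
    linear_combination h
  set N : ℤ → ℝ := fun k => τ * ‖u k‖ + ‖u (k + 1)‖ with hN
  have hlim : Tendsto N atBot (𝓝 0) := by
    have h0 := (tendsto_cofinite_of_memℓp_two (lp.memℓp u)).mono_left atBot_le_cofinite_int
    have h1 := (h0.norm.const_mul τ).add
      (h0.comp (tendsto_atBot_add_const_right _ (1 : ℤ) tendsto_id)).norm
    simpa using h1
  have hsmall : ∀ᶠ k in atBot, q * offDiag q t k < τ * (1 - τ) := by
    have h1 := (tendsto_offDiag_atBot (t := t) hq hq1).const_mul q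
    rw [mul_zero] at h1
    exact h1.eventually_lt_const (mul_pos hτ0 (by linarith))
  obtain ⟨k₀, hk₀⟩ := eventually_atBot.1 hsmall
  have hmono : ∀ k ≤ k₀, N k ≤ N (k - 1) := fun k hk => by
    have h1 : σ * ‖u (k - 1)‖ ≥ ‖u (k + 1)‖ - q * offDiag q t k * ‖u k‖ := by
      have h2 := congrArg norm (hrec k)
      rw [norm_mul, Complex.norm_real, Real.norm_of_nonneg hσ0.le] at h2
      rw [h2, norm_sub_rev]
      refine le_trans ?_ (norm_sub_norm_le _ _)
      rw [norm_mul, Complex.norm_real,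
        Real.norm_of_nonneg (mul_pos hq (offDiag_pos hq ht k)).le]
    have h2 := hk₀ k hk
    have h3 : τ * N k ≤ τ * N (k - 1) := by
      simp only [hN, sub_add_cancel]
      have h4 : q * offDiag q t k * ‖u k‖ ≤ τ * (1 - τ) * ‖u k‖ := by gcongr
      have h5 : τ * ‖u (k + 1)‖ ≤ ‖u (k + 1)‖ :=
        mul_le_of_le_one_left (norm_nonneg _) hτ1.le
      calc τ * (τ * ‖u k‖ + ‖u (k + 1)‖) ≤ τ * τ * ‖u k‖ + ‖u (k + 1)‖ := by linarith
        _ ≤ σ * ‖u (k - 1)‖ + τ * ‖u k‖ := by linarith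
        _ = τ * (τ * ‖u (k - 1)‖ + ‖u k‖) := by rw [← hτσ]; ring
    exact le_of_mul_le_mul_left h3 hτ0
  have hle : ∀ n : ℕ, N k₀ ≤ N (k₀ - n) := fun n => by
    induction n with
    | zero => simp
    | succ n ih =>
      refine ih.trans ((hmono _ (by omega)).trans_eq ?_)
      congr 1
      push_cast
      ring
  -- Square summability sends `N` to zero at `-∞`, while `N` does not decrease in that direction.
  have h0 : N k₀ ≤ 0 := by
    have h1 : Tendsto (fun n : ℕ => k₀ - (n : ℤ)) atTop atBot :=
      tendsto_atBot_add_const_left _ k₀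
        (tendsto_neg_atTop_atBot.comp tendsto_natCast_atTop_atTop)
    exact ge_of_tendsto' (hlim.comp h1) hle
  have h1 : ‖u k₀‖ = 0 := by
    have := norm_nonneg (u (k₀ + 1))
    have h3 : τ * ‖u k₀‖ ≤ 0 := by linarith [h0, show N k₀ = τ * ‖u k₀‖ + ‖u (k₀ + 1)‖ from rfl]
    nlinarith [norm_nonneg (u k₀)]
  have h2 : ‖u (k₀ + 1)‖ = 0 := by
    have h3 : N k₀ = τ * ‖u k₀‖ + ‖u (k₀ + 1)‖ := rfl
    rw [h1, mul_zero, zero_add] at h3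
    exact le_antisymm (h3 ▸ h0) (norm_nonneg _)
  ext k
  exact eq_zero_of_jacobiAction (z := 0) hq ht (fun k => by rw [hu, zero_mul])
    (norm_eq_zero.1 h1) (norm_eq_zero.1 h2) k

end NoEigenvector

/-! ### The spectrum -/

section Spectrum

lemma pointSpectrum_subset_spectrum {H : Type*} [NormedAddCommGroup H] [InnerProductSpace ℂ H]
    (A : H →ₗ.[ℂ] H) : pointSpectrum A ⊆ spectrum A := by
  rintro z ⟨x, hx, hxz⟩ ⟨R, -, hR⟩
  have h := hR x
  rw [hxz, sub_self, map_zero] at h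
  exact hx (Subtype.ext h.symm)

variable {q t : ℝ} {z : ℂ}

lemma mem_pointSpectrum_iff (q t : ℝ) :
    z ∈ pointSpectrum (jacobi q t)† ↔
      ∃ u : EllTwo, u ≠ 0 ∧ ∀ k, jacobiAction q t u k = z * u k := by
  constructor
  · rintro ⟨x, hx, hxz⟩
    refine ⟨x, fun h => hx (Subtype.ext h), fun k => ?_⟩
    rw [← adjoint_apply_eq_jacobiAction, hxz]
    rfl
  · rintro ⟨u, hu, huz⟩
    have hmem : u ∈ (jacobi q t)†.domain := by
      rw [mem_adjoint_domain_iff]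
      refine cast (congrArg (Memℓp · 2) (funext fun k => ?_)) ((lp.memℓp u).const_mul z)
      exact (huz k).symm
    refine ⟨⟨u, hmem⟩, fun h => hu (congrArg Subtype.val h), ?_⟩
    ext k
    rw [adjoint_apply_eq_jacobiAction, huz]
    rfl

lemma mem_pointSpectrum_of_memℓp (hq : 0 < q) (hq1 : q < 1) (ht : 0 < t) (hz : z ≠ 0)
    (h : Memℓp (eigenSeq q t z) 2) : z ∈ pointSpectrum (jacobi q t)† := by
  obtain ⟨k, hk⟩ := eigenSeq_ne_zero hq hq1 ht hz
  exact (mem_pointSpectrum_iff q t).2 ⟨⟨_, h⟩, fun h0 => hk (congrArg (fun v : EllTwo => v k) h0),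
    jacobiAction_eigenSeq hq hq1 ht hz⟩

lemma pow_mem_pointSpectrum (hq : 0 < q) (hq1 : q < 1) (ht : 0 < t) (n : ℕ) :
    (q : ℂ) ^ n ∈ pointSpectrum (jacobi q t)† :=
  mem_pointSpectrum_of_memℓp hq hq1 ht (pow_ne_zero _ (by exact_mod_cast hq.ne'))
    (memℓp_eigenSeq_pow hq hq1 ht n)

lemma neg_zpow_div_mem_pointSpectrum (hq : 0 < q) (hq1 : q < 1) (ht : 0 < t) (r : ℤ) :
    -(q : ℂ) ^ r / t ∈ pointSpectrum (jacobi q t)† :=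
  mem_pointSpectrum_of_memℓp hq hq1 ht
    (div_ne_zero (neg_ne_zero.2 (zpow_ne_zero _ (by exact_mod_cast hq.ne')))
      (by exact_mod_cast ht.ne')) (memℓp_eigenSeq_neg hq hq1 ht r rfl)

lemma zero_notMem_pointSpectrum (hq : 0 < q) (hq1 : q < 1) (ht : 0 < t) :
    (0 : ℂ) ∉ pointSpectrum (jacobi q t)† := by
  rw [mem_pointSpectrum_iff]
  rintro ⟨u, hu, huz⟩
  exact hu (eq_zero_of_jacobiAction_eq_zero hq hq1 ht fun k => by rw [huz, zero_mul])

/-- A limit of eigenvalues belongs to the spectrum. -/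
lemma mem_spectrum_of_tendsto {H : Type*} [NormedAddCommGroup H] [InnerProductSpace ℂ H]
    {A : H →ₗ.[ℂ] H} {μ : ℕ → ℂ} {z : ℂ} (hμ : ∀ n, μ n ∈ pointSpectrum A)
    (h : Tendsto μ atTop (𝓝 z)) : z ∈ spectrum A := by
  rintro ⟨R, -, hR⟩
  have h1 : ∀ n, 1 ≤ ‖R‖ * ‖μ n - z‖ := fun n => by
    obtain ⟨x, hx, hxμ⟩ := hμ n
    have h2 := hR x
    rw [hxμ, ← sub_smul] at h2
    have h3 := R.le_opNorm ((μ n - z) • (x : H))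
    rw [h2, norm_smul, ← mul_assoc] at h3
    have h4 : 0 < ‖(x : H)‖ := norm_pos_iff.2 fun h0 => hx (Subtype.ext h0)
    exact le_of_mul_le_mul_right (by rwa [one_mul]) h4
  have h5 := ((h.sub_const z).norm.const_mul ‖R‖)
  rw [sub_self, norm_zero, mul_zero] at h5
  exact absurd (ge_of_tendsto' h5 h1) (by norm_num)

/-- All nonzero points are eigenvalues; only `0` needs the limit argument. -/
theorem spectrum_adjoint (hq : 0 < q) (hq1 : q < 1) (ht : 0 < t) :
    spectrum (jacobi q t)† =
      (Set.range fun r : ℤ => ((-(q ^ r / t) : ℝ) : ℂ)) ∪ {0} ∪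
        (Set.range fun n : ℕ => ((q ^ n : ℝ) : ℂ)) := by
  ext z
  constructor
  · intro hz
    by_contra hn
    simp only [Set.mem_union, Set.mem_range, Set.mem_singleton_iff, not_or, not_exists] at hn
    obtain ⟨⟨h1, h0⟩, h2⟩ := hn
    refine hz (mem_resolventSet_of_forall_eq_zero hq hq1 ht h0 fun v hv =>
      eq_zero_of_jacobiAction_eq hq hq1 ht h0 (fun n hn => h2 n ?_) (fun r hr => h1 r ?_) hv)
    · rw [hn]; push_cast; rfl
    · rw [hr]; push_cast; ring
  · rintro ((⟨r, rfl⟩ | rfl) | ⟨n, rfl⟩)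
    · have := pointSpectrum_subset_spectrum _ (neg_zpow_div_mem_pointSpectrum hq hq1 ht r)
      convert this using 1
      push_cast
      ring
    · exact mem_spectrum_of_tendsto (pow_mem_pointSpectrum hq hq1 ht) (tendsto_ofReal_pow hq hq1)
    · have := pointSpectrum_subset_spectrum _ (pow_mem_pointSpectrum hq hq1 ht n)
      convert this using 1
      push_cast
      rfl

theorem accPt_zero_spectrum (hq : 0 < q) (hq1 : q < 1) (ht : 0 < t) :
    AccPt (0 : ℂ) (𝓟 (spectrum (jacobi q t)†)) := by
  rw [accPt_iff_frequently]
  refine (tendsto_ofReal_pow hq hq1).frequently (Frequently.of_forall fun n => ⟨?_, ?_⟩)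
  · exact pow_ne_zero _ (by exact_mod_cast hq.ne')
  · exact pointSpectrum_subset_spectrum _ (pow_mem_pointSpectrum hq hq1 ht n)

end Spectrum

end SWSpectrum

end

theorem theorem3p3 (q t : ℝ) (hq0 : 0 < q) (hq1 : q < 1) (ht : 0 < t) :
    -- the adjoint of `J` is self-adjoint and is the closure of `J`
    IsSelfAdjoint (SWSpectrum.jacobi q t)† ∧
    (SWSpectrum.jacobi q t).IsClosable ∧
    (SWSpectrum.jacobi q t).closure = (SWSpectrum.jacobi q t)† ∧
    -- the spectrum
    SWSpectrum.spectrum (SWSpectrum.jacobi q t)† =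
      (Set.range fun r : ℤ => ((-(q ^ r / t) : ℝ) : ℂ)) ∪ {0} ∪
        (Set.range fun n : ℕ => ((q ^ n : ℝ) : ℂ)) ∧
    -- the point zero is an accumulation point of the spectrum, but not an eigenvalue
    AccPt (0 : ℂ) (𝓟 (SWSpectrum.spectrum (SWSpectrum.jacobi q t)†)) ∧
    (0 : ℂ) ∉ SWSpectrum.pointSpectrum (SWSpectrum.jacobi q t)† :=
  ⟨SWSpectrum.isSelfAdjoint_adjoint hq0 hq1 ht, SWSpectrum.isClosable_jacobi q t,
    SWSpectrum.closure_jacobi hq0 hq1 ht, SWSpectrum.spectrum_adjoint hq0 hq1 ht,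
    SWSpectrum.accPt_zero_spectrum hq0 hq1 ht, SWSpectrum.zero_notMem_pointSpectrum hq0 hq1 ht⟩
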